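/- Let $0<p<1/2$, let $Y^n$ be uniform on $GF(2)^n$, let $Z^n$ be i.i.d. Bernoulli$(p)$ independent of $Y^n$, and let $X^n=Y^n+Z^n$. The encoder observes $X^n$, the decoder observes $Y^n$ (side information), and the distortion is the expected normalized Hamming distance. Write $H$ for the binary entropy function in bits, $a\ast b=a(1-b)+b(1-a)$, and $R_1^\ast(D)=H(p\ast D)-H(D)$. *Superposition scheme.* For $n,R_0,R_1,q,D$ and tolerances $0<\varepsilon<\varepsilon'$, let the codebook $\mathcal C_0$ consist of $\lceil 2^{nR_0}\rceil$ i.i.d. uniform words and let $\mathcal C_1$ consist of $\lceil 2^{nR_1}\rceil$ words with i.i.d. Bernoulli$(q)$ letters, all independent of each other and of the source. The encoder chooses uniformly at random a pair $(c_0^n,c_1^n)\in\mathcal C_0\times\mathcal C_1$ among those for which $c_0^n+c_1^n$ is strongly $\varepsilon$-jointly typical with $x^n$ (for a uniform input and additive Bernoulli$(D)$ noise), or among all pairs if there is none, and sends the index of $c_1^n$. There is an encoder error if $d_H(x^n,c_0^n+c_1^n)/n>D+\varepsilon$. For a word $w$ let $T(w)$ be a word of $\mathcal C_0$ that is strongly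 $\varepsilon'$-jointly typical with $w$ (for a uniform input and additive Bernoulli$(p\ast D)$ noise) if there is one, and any word of $\mathcal C_0$ otherwise. The decoder reconstructs $\hat x^n=y^n+\big(T(y^n-c_1^n)-(y^n-c_1^n)\big)$. There is a decoder error if the codeword $c_0^n$ chosen by the encoder is not the one and only codeword of $\mathcal C_0$ that is $\varepsilon'$-jointly typical with $y^n-c_1^n$. The rate region is $$\mathcal R(q,D)=\{(R_0,R_1): R_0>1-H(q\ast D),\ R_0+R_1>1-H(D),\ R_0\le 1-H(p\ast D)\}.$$ *Claim.* 1. Let $0\le D<1/2$. There are $q\in[0,1]$ with $H(q\ast D)>H(p\ast D)$. For every such $q$, a number $R_1$ satisfies $(R_0,R_1)\in\mathcal R(q,D)$ for some $R_0$ if and only if $R_1>R_1^\ast(D)$; and $R_0$ can then be taken with $R_0<1-H(p\ast D)$. For every $(R_0,R_1)\in\mathcal R(q,D)$ with $R_0<1-H(p\ast D)$ there is $\varepsilon_0>0$ such that for all $0<\varepsilon<\varepsilon'<\varepsilon_0$ the probabilities of an encoder error and of a decoder error tend to $0$ as $n\to\infty$. So the scheme can operate with $R_1$ arbitrarily close to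 $R_1^\ast(D)$. 2. There is exactly one $D'\in(0,p)$ at which the tangent to the curve $D\mapsto R_1^\ast(D)$ passes through the point $(p,0)$, i.e. $\frac{dR_1^\ast}{dD}(D')=\frac{R_1^\ast(D')}{D'-p}$. Let $R_{WZ}(D)$ be the Wyner–Ziv rate-distortion function: the least $R$ such that for every $\eta>0$ and all large $n$ there is a code of length $n$ (encoder seeing $X^n$ only; decoder seeing the message and $Y^n$) with at most $2^{n(R+\eta)}$ messages and distortion at most $D+\eta$. Then $R_{WZ}(D)=R_1^\ast(D)$ for $0\le D\le D'$. 3. For $D'<D\le p$, with $t=\frac{p-D}{p-D'}$, so that $D=tD'+(1-t)p$, one has $R_{WZ}(D)=t\,R_1^\ast(D')+(1-t)\cdot 0$, and time-sharing between the working points $(R_1^\ast(D'),D')$ and $(0,p)$ attains it. That is, for every $q\in[0,1]$ with $H(q\ast D')>H(p\ast D')$ and every $\eta>0$ there are $(R_0,R_1)\in\mathcal R(q,D')$ with $R_1<R_1^\ast(D')+\eta$ and tolerances $0<\varepsilon<\varepsilon'<\eta$ such that for all large $n$ some superposition code (fixed codebooks of sizes $\lceil 2^{mR_0}\rceil$,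 $\lceil 2^{mR_1}\rceil$, fixed selections, test distortion $D'$), used on the first $m=\lfloor tn\rfloor$ symbols and combined with the reconstruction $\hat x=y$ at rate zero on the other $n-m$ symbols, has at most $2^{n(R_{WZ}(D)+\eta)}$ messages and distortion at most $D+\eta$. -/

import Mathlib

open Filter Topology

namespace SuperpositionWZ

/-! ### Binary laws and entropies (in bits) -/

/-- Words of length `n` over `GF(2)`. -/
abbrev Word (n : ℕ) : Type := Fin n → ZMod 2

/-- The Bernoulli law `B(p)` on `GF(2)`: probability `p` of the symbol `1`. -/
noncomputable def bern (p : ℝ) : ZMod 2 → ℝ := fun a => if a = 0 then 1 - p else p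

/-- Law of the sum in `GF(2)` of two independent variables with laws `P` and `Q`. -/
noncomputable def conv (P Q : ZMod 2 → ℝ) : ZMod 2 → ℝ := fun c => ∑ a, P a * Q (c - a)

/-- Shannon entropy in bits of a law on `GF(2)`. -/
noncomputable def entropyBits (P : ZMod 2 → ℝ) : ℝ := ∑ a, Real.negMulLog (P a) / Real.log 2

/-- The binary entropy function `H`, in bits. -/
noncomputable def h2 (p : ℝ) : ℝ := Real.binEntropy p / Real.log 2

/-- `p ∗ q = p (1 - q) + q (1 - p)`. -/
def star (p q : ℝ) : ℝ := p * (1 - q) + q * (1 - p)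

/-- `R₁* = H(p ∗ D) - H(D)`. -/
noncomputable def R1star (p D : ℝ) : ℝ := h2 (star p D) - h2 D

/-- The rate region of the superposition scheme over `GF(2)` (so `l = 1`): pairs `(R₀, R₁)` with
`R₀ > l - H(q ∗ d)`, `R₀ + R₁ > l - H(d)` and `R₀ ≤ l - H(p ∗ d)`, where `d = B(D)`. -/
noncomputable def rateRegion (p q D : ℝ) : Set (ℝ × ℝ) :=
  {R | 1 - entropyBits (conv (bern q) (bern D)) < R.1 ∧
    1 - entropyBits (bern D) < R.1 + R.2 ∧
    R.1 ≤ 1 - entropyBits (conv (bern p) (bern D))}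

/-! ### Strong joint typicality -/

/-- Number of positions in which the pair of words `(u, v)` shows the symbols `(a, b)`. -/
def pairCount {n : ℕ} (u v : Word n) (a b : ZMod 2) : ℕ :=
  (Finset.univ.filter fun k : Fin n => u k = a ∧ v k = b).card

/-- Joint law of `(A, A + N)` with `A` uniform on `GF(2)` and `N` independent of `A`. -/
noncomputable def additiveLaw (N : ZMod 2 → ℝ) : ZMod 2 → ZMod 2 → ℝ :=
  fun a b => bern (1 / 2) a * N (b - a)

/-- `(u, v)` is strongly `ε`-jointly typical for the joint law `P` on `GF(2) × GF(2)`: all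
empirical frequencies are within `ε / 4` (4 being the size of the product alphabet) of the
probabilities, and pairs of symbols of probability zero do not occur. -/
def JointlyTypical {n : ℕ} (ε : ℝ) (P : ZMod 2 → ZMod 2 → ℝ) (u v : Word n) : Prop :=
  ∀ a b, (P a b = 0 → pairCount u v a b = 0) ∧ |(pairCount u v a b : ℝ) / n - P a b| < ε / 4

/-! ### The superposition scheme -/

/-- Number of codewords of a code of length `n` and rate `R` bit/symbol. -/
noncomputable def codeSize (R : ℝ) (n : ℕ) : ℕ := ⌈(2 : ℝ) ^ ((n : ℝ) * R)⌉₊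

open Classical in
/-- The elements with property `A`, or all elements if there is none. -/
noncomputable def orAll {α : Type} [Fintype α] (A : α → Prop) : Finset α :=
  if ∃ a, A a then Finset.univ.filter A else Finset.univ

/-- The index pairs among which the encoder chooses for the source word `x`: those with
`c₀ + c₁` jointly typical with `x` (test channel with noise `B(D)`), or all pairs if none is. -/
noncomputable def encChoices {n M₀ M₁ : ℕ} (D ε : ℝ) (c₀ : Fin M₀ → Word n) (c₁ : Fin M₁ → Word n)
    (x : Word n) : Finset (Fin M₀ × Fin M₁) :=
  orAll fun s => JointlyTypical ε (additiveLaw (bern D)) (c₀ s.1 + c₁ s.2) x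

/-- Codeword `i` of the first code is jointly typical with `w`, for additive noise `p ∗ d`. -/
def DecTypical {n M₀ : ℕ} (p D ε : ℝ) (c₀ : Fin M₀ → Word n) (w : Word n) (i : Fin M₀) : Prop :=
  JointlyTypical ε (additiveLaw (conv (bern p) (bern D))) (c₀ i) w

/-- The indices allowed for `T_{C₀}(w)`. -/
noncomputable def decChoices {n M₀ : ℕ} (p D ε : ℝ) (c₀ : Fin M₀ → Word n) (w : Word n) :
    Finset (Fin M₀) :=
  orAll (DecTypical p D ε c₀ w)

/-- Probability of a word with i.i.d. letters of law `P`. -/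
noncomputable def iidProb {n : ℕ} (P : ZMod 2 → ℝ) (u : Word n) : ℝ := ∏ k, P (u k)

open Classical in
/-- Probability of the event `E` when the codewords of `C₀` are i.i.d. uniform, those of `C₁` are
i.i.d. with letters `B(q)`, the side information `y` is uniform, the noise `z` is i.i.d. `B(p)`,
all of these are independent, and the encoder, which sees `x = y + z` and the codes, draws its
index pair `s` uniformly from `encChoices`. -/
noncomputable def schemeProb (p q D ε : ℝ) (n M₀ M₁ : ℕ)
    (E : (Fin M₀ → Word n) → (Fin M₁ → Word n) → Word n → Word n → Fin M₀ × Fin M₁ → Prop) : ℝ :=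
  ∑ c₀ : Fin M₀ → Word n, ∑ c₁ : Fin M₁ → Word n, ∑ y : Word n, ∑ z : Word n,
    (∏ i, iidProb (bern (1 / 2)) (c₀ i)) * (∏ j, iidProb (bern q) (c₁ j)) *
      iidProb (bern (1 / 2)) y * iidProb (bern p) z *
      ((((encChoices D ε c₀ c₁ (y + z)).filter (E c₀ c₁ y z)).card : ℝ) /
        (encChoices D ε c₀ c₁ (y + z)).card)

/-- Probability of an encoder error: the chosen `c₀ + c₁` is at normalized Hamming distance more
than `D + ε` from the source word. -/
noncomputable def encErrorProb (p q D R₀ R₁ ε : ℝ) (n : ℕ) : ℝ :=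
  schemeProb p q D ε n (codeSize R₀ n) (codeSize R₁ n) fun c₀ c₁ y z s =>
    (n : ℝ) * (D + ε) < hammingDist (y + z) (c₀ s.1 + c₁ s.2)

/-- Probability of a decoder error: the chosen codeword of `C₀` is not the one and only codeword
of `C₀` jointly typical (with tolerance `ε'`) with `y - c₁`. -/
noncomputable def decErrorProb (p q D R₀ R₁ ε ε' : ℝ) (n : ℕ) : ℝ :=
  schemeProb p q D ε n (codeSize R₀ n) (codeSize R₁ n) fun c₀ c₁ y _ s =>
    ¬ (DecTypical p D ε' c₀ (y - c₁ s.2) s.1 ∧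
      ∀ i, DecTypical p D ε' c₀ (y - c₁ s.2) i → i = s.1)

/-! ### Source coding with side information at the decoder -/

/-- A code of length `n` with message set `M`: the encoder sees the source word only, the decoder
sees the message and the side information. -/
structure WZCode (n : ℕ) (M : Type) where
  enc : Word n → M
  dec : M → Word n → Word n

/-- `E[d_H(Xⁿ, X̂ⁿ) / n]` for `X = Y + Z`, `Y` uniform, `Z ~ B(p)` independent of `Y`. -/
noncomputable def WZCode.distortion {n : ℕ} {M : Type} (C : WZCode n M) (p : ℝ) : ℝ :=
  ∑ y : Word n, ∑ z : Word n, iidProb (bern (1 / 2)) y * iidProb (bern p) z *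
    ((hammingDist (y + z) (C.dec (C.enc (y + z)) y) : ℝ) / n)

/-- The pair `(R, D)` is achievable for the doubly symmetric binary source with parameter `p` and
side information at the decoder. -/
def WZAchievable (p R D : ℝ) : Prop :=
  ∀ η : ℝ, 0 < η → ∀ᶠ n : ℕ in atTop, ∃ (M : ℕ) (C : WZCode n (Fin M)),
    (M : ℝ) ≤ (2 : ℝ) ^ ((n : ℝ) * (R + η)) ∧ C.distortion p ≤ D + η

/-- `R` is the value at `D` of the Wyner-Ziv rate-distortion function: the least rate `R` for
which `(R, D)` is achievable. -/
def IsWZRate (p D R : ℝ) : Prop := IsLeast {R' : ℝ | WZAchievable p R' D} R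

/-- `C` is a superposition code with test distortion `D`, typicality tolerances `ε` (encoder) and
`ε'` (decoder), and first codebook of size `M₀`: the encoder sends the index of `c₁`, and the
decoder reconstructs `y + [y - c₁]_{C₀}` with `[w]_{C₀} = T_{C₀}(w) - w`. -/
def IsSuperpositionCode {n M₁ : ℕ} (p D ε ε' : ℝ) (M₀ : ℕ) (C : WZCode n (Fin M₁)) : Prop :=
  ∃ (c₀ : Fin M₀ → Word n) (c₁ : Fin M₁ → Word n) (s : Word n → Fin M₀ × Fin M₁)
    (T : Word n → Fin M₀),
    (∀ x, s x ∈ encChoices D ε c₀ c₁ x) ∧ (∀ w, T w ∈ decChoices p D ε' c₀ w) ∧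
    (∀ x, C.enc x = (s x).2) ∧
    ∀ j y, C.dec j y = y + (c₀ (T (y - c₁ j)) - (y - c₁ j))

/-- The code of rate zero that reconstructs the source by the side information. -/
def sideInfoCode (n : ℕ) : WZCode n Unit where
  enc _ := ()
  dec _ y := y

/-- Time-sharing: the first code on the first `m` letters, the second on the last `k` ones. -/
def timeShare {m k : ℕ} {M M' : Type} (C : WZCode m M) (C' : WZCode k M') :
    WZCode (m + k) (M × M') where
  enc x := (C.enc fun i => x (Fin.castAdd k i), C'.enc fun i => x (Fin.natAdd m i))
  dec w y := Fin.append (C.dec w.1 fun i => y (Fin.castAdd k i))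
    (C'.dec w.2 fun i => y (Fin.natAdd m i))

/-- `D'` is a threshold distortion for `p`: `0 < D' < p`, and the tangent to `D ↦ H(p ∗ D) - H(D)`
at `D'` passes through the point `(p, 0)`. -/
def IsThreshold (p D' : ℝ) : Prop :=
  0 < D' ∧ D' < p ∧ HasDerivAt (R1star p) (R1star p D' / (D' - p)) D'

end SuperpositionWZ

open SuperpositionWZ

/-!
# Superposition codes for the binary Wyner–Ziv problem

Achievability is a random coding argument. Some sum `c₀ + c₁` is typical with the source word by the
second-moment method: the expected number of such pairs of codewords grows when
`R₀ + R₁ > 1 - H(D)`, and `R₀ > 1 - H(q ∗ D)` bounds the correlation between pairs that share `c₀`.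
Given a typical sum, `y - c₁` is `c₀` plus noise of frequency nearly `p ∗ D`, while the other words
of `𝒞₀` are uniform and independent of it, so that decoding succeeds when `R₀ < 1 - H(p ∗ D)`.
Averaging over the codebooks yields a good fixed code.

For the converse, the convex function `g(d) = H(p ∗ d) - H(d)` lies above its tangents, and the
tangents at `d ≤ D'` pass on or below the point `(p, 0)`. Hence the rate and the distortion of one
letter lie above such a tangent, whether the decoder uses the message or relies on `y` alone, and an
induction over the block length extends this to all codes. On `[0, D']` the tangents recover `g`;
beyond `D'` the tangent at `D'` is the chord to `(p, 0)`, which time-sharing attains.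
-/

namespace SuperpositionWZ

/-! ### The curve `H(p ∗ d) - H(d)` -/

section Curve

variable {p d d' : ℝ}

lemma star_eq_add_mul (p d : ℝ) : star p d = p + (1 - 2 * p) * d := by unfold star; ring

lemma star_one_sub (p d : ℝ) : star p (1 - d) = 1 - star p d := by unfold star; ring

lemma star_mem_Icc (hp : p ∈ Set.Icc 0 1) (hd : d ∈ Set.Icc 0 1) : star p d ∈ Set.Icc 0 1 := by
  obtain ⟨hp0, hp1⟩ := hp
  obtain ⟨hd0, hd1⟩ := hd
  unfold star
  exact ⟨by nlinarith, by nlinarith⟩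

lemma star_mem_Ioo (hp : p ∈ Set.Ioo 0 1) (hd : d ∈ Set.Icc 0 1) : star p d ∈ Set.Ioo 0 1 := by
  obtain ⟨⟨hp0, hp1⟩, hd0, hd1⟩ := And.intro hp hd
  unfold star
  constructor <;> nlinarith [mul_nonneg hp0.le hd0, mul_nonneg hp0.le (sub_nonneg.2 hd1)]

lemma star_ne_half (hp : p ≠ 1 / 2) (hd : d ≠ 1 / 2) : star p d ≠ 1 / 2 := by
  have hprod : (p - 1 / 2) * (d - 1 / 2) ≠ 0 := mul_ne_zero (sub_ne_zero.2 hp) (sub_ne_zero.2 hd)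
  contrapose! hprod
  unfold star at hprod
  linarith

lemma continuous_star (p : ℝ) : Continuous (star p) := by unfold star; fun_prop

lemma hasDerivAt_star (p d : ℝ) : HasDerivAt (star p) (1 - 2 * p) d := by
  rw [show star p = fun d => p + (1 - 2 * p) * d from funext (star_eq_add_mul p)]
  simpa using ((hasDerivAt_id d).const_mul (1 - 2 * p)).const_add p

lemma log_two_pos : 0 < Real.log 2 := Real.log_pos one_lt_two

/-- The curve `H(p ∗ d) - H(d)` in nats, that is, `log 2` times `R1star p d`. -/
noncomputable def gainNats (p d : ℝ) : ℝ := Real.binEntropy (star p d) - Real.binEntropy d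

/-- The slope of the curve `gainNats p` at `d`. -/
noncomputable def gainSlope (p d : ℝ) : ℝ :=
  (1 - 2 * p) * (Real.log (1 - star p d) - Real.log (star p d)) - (Real.log (1 - d) - Real.log d)

lemma R1star_eq_gainNats_div (p d : ℝ) : R1star p d = gainNats p d / Real.log 2 := by
  simp only [R1star, gainNats, h2, sub_div]

lemma continuous_gainNats (p : ℝ) : Continuous (gainNats p) := by
  have := continuous_star p
  unfold gainNats
  fun_prop

lemma gainNats_one_sub (p d : ℝ) : gainNats p (1 - d) = gainNats p d := by
  simp only [gainNats, star_one_sub, Real.binEntropy_one_sub]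

lemma gainNats_pos (hp : p ∈ Set.Ioo 0 1) (hd : d ∈ Set.Icc 0 1) (hne : d ≠ 1 / 2) :
    0 < gainNats p d := by
  have hd' : 1 - d ∈ Set.Icc (0 : ℝ) 1 := ⟨by linarith [hd.2], by linarith [hd.1]⟩
  have hlt := Real.strictConcave_binEntropy.2 hd hd' (fun h => hne (by linarith))
    (sub_pos.2 hp.2) hp.1 (sub_add_cancel 1 p)
  have hstar : (1 - p) • d + p • (1 - d) = star p d := by
    simp only [smul_eq_mul, star]; ring
  rw [hstar, Real.binEntropy_one_sub, ← add_smul, sub_add_cancel, one_smul] at hlt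
  exact sub_pos.2 hlt

lemma gainNats_nonneg (hp : p ∈ Set.Ioo 0 1) (hd : d ∈ Set.Icc 0 1) : 0 ≤ gainNats p d := by
  rcases eq_or_ne d (1 / 2) with rfl | hne
  · have hstar : star p (1 / 2) = 1 / 2 := by unfold star; ring
    rw [gainNats, hstar, sub_self]
  · exact (gainNats_pos hp hd hne).le

lemma R1star_pos (hp : p ∈ Set.Ioo 0 1) (hd : d ∈ Set.Icc 0 1) (hne : d ≠ 1 / 2) :
    0 < R1star p d := by
  rw [R1star_eq_gainNats_div]
  exact div_pos (gainNats_pos hp hd hne) log_two_pos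

lemma hasDerivAt_gainNats (hp : p ∈ Set.Ioo 0 1) (hd : d ∈ Set.Ioo 0 1) :
    HasDerivAt (gainNats p) (gainSlope p d) d := by
  have hs := star_mem_Ioo hp (Set.Ioo_subset_Icc_self hd)
  rw [gainSlope, mul_comm]
  exact ((Real.hasDerivAt_binEntropy hs.1.ne' hs.2.ne).comp d (hasDerivAt_star p d)).sub
    (Real.hasDerivAt_binEntropy hd.1.ne' hd.2.ne)

lemma hasDerivAt_gainSlope (hp : p ∈ Set.Ioo 0 1) (hd : d ∈ Set.Ioo 0 1) :
    HasDerivAt (gainSlope p)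
      (1 / (d * (1 - d)) - (1 - 2 * p) ^ 2 / (star p d * (1 - star p d))) d := by
  obtain ⟨hs0, hs1⟩ := star_mem_Ioo hp (Set.Ioo_subset_Icc_self hd)
  have hs1' : 1 - star p d ≠ 0 := (sub_pos.2 hs1).ne'
  have hd1 : 1 - d ≠ 0 := (sub_pos.2 hd.2).ne'
  have hd0 : d ≠ 0 := hd.1.ne'
  have hstar := hasDerivAt_star p d
  have hder := ((((hstar.const_sub 1).log hs1').sub (hstar.log hs0.ne')).const_mul (1 - 2 * p)).sub
    ((((hasDerivAt_id d).const_sub 1).log hd1).sub ((hasDerivAt_id d).log hd0))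
  refine hder.congr_deriv ?_
  simp only [id]
  field_simp
  ring

lemma strictMonoOn_gainSlope (hp : p ∈ Set.Ioo 0 1) :
    StrictMonoOn (gainSlope p) (Set.Ioo 0 1) := by
  refine strictMonoOn_of_deriv_pos (convex_Ioo 0 1)
    (fun d hd => (hasDerivAt_gainSlope hp hd).continuousAt.continuousWithinAt) fun d hd => ?_
  rw [interior_Ioo] at hd
  obtain ⟨hs0, hs1⟩ := star_mem_Ioo hp (Set.Ioo_subset_Icc_self hd)
  rw [(hasDerivAt_gainSlope hp hd).deriv, sub_pos,
    div_lt_div_iff₀ (mul_pos hs0 (sub_pos.2 hs1)) (mul_pos hd.1 (sub_pos.2 hd.2))]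
  have hgap : star p d * (1 - star p d) - (1 - 2 * p) ^ 2 * (d * (1 - d)) = p * (1 - p) := by
    unfold star; ring
  linarith [mul_pos hp.1 (sub_pos.2 hp.2)]

lemma strictConvexOn_gainNats (hp : p ∈ Set.Ioo 0 1) :
    StrictConvexOn ℝ (Set.Icc 0 1) (gainNats p) := by
  refine StrictMonoOn.strictConvexOn_of_deriv (convex_Icc 0 1)
    (continuous_gainNats p).continuousOn ?_
  rw [interior_Icc]
  exact (strictMonoOn_gainSlope hp).congr fun d hd => (hasDerivAt_gainNats hp hd).deriv.symm

lemma gainNats_tangent_le (hp : p ∈ Set.Ioo 0 1) (hd : d ∈ Set.Ioo 0 1) (hd' : d' ∈ Set.Icc 0 1) :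
    gainNats p d + gainSlope p d * (d' - d) ≤ gainNats p d' := by
  have hconvex := (strictConvexOn_gainNats hp).convexOn
  have hderiv := hasDerivAt_gainNats hp hd
  have hdI := Set.Ioo_subset_Icc_self hd
  rcases lt_trichotomy d' d with h | rfl | h
  · have := hconvex.slope_le_of_hasDerivAt hd' hdI h hderiv
    rw [slope_def_field, div_le_iff₀ (sub_pos.2 h)] at this
    linarith
  · simp
  · have := hconvex.le_slope_of_hasDerivAt hdI hd' h hderiv
    rw [slope_def_field, le_div_iff₀ (sub_pos.2 h)] at this
    linarith

/-- How far below the point `(p, 0)` the tangent to `gainNats p` at `d` passes; its zero in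
`(0, p)` is the threshold distortion. -/
noncomputable def tangentGap (p d : ℝ) : ℝ := gainSlope p d * (d - p) - gainNats p d

lemma strictAntiOn_tangentGap (hp : p ∈ Set.Ioo 0 1) :
    StrictAntiOn (tangentGap p) (Set.Ioo 0 p) := by
  intro d₁ h₁ d₂ h₂ h₁₂
  have hd₁ : d₁ ∈ Set.Ioo (0 : ℝ) 1 := ⟨h₁.1, h₁.2.trans hp.2⟩
  have hd₂ : d₂ ∈ Set.Ioo (0 : ℝ) 1 := ⟨h₂.1, h₂.2.trans hp.2⟩
  have htangent := gainNats_tangent_le hp hd₁ (Set.Ioo_subset_Icc_self hd₂)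
  have hslope : gainSlope p d₂ * (d₂ - p) < gainSlope p d₁ * (d₂ - p) :=
    mul_lt_mul_of_neg_right (strictMonoOn_gainSlope hp hd₁ hd₂ h₁₂) (sub_neg.2 h₂.2)
  unfold tangentGap; linarith

lemma continuousOn_tangentGap (hp : p ∈ Set.Ioo 0 1) :
    ContinuousOn (tangentGap p) (Set.Ioo 0 1) := fun _ hd =>
  (((hasDerivAt_gainSlope hp hd).continuousAt.mul (by fun_prop)).sub
    (continuous_gainNats p).continuousAt).continuousWithinAt

lemma tendsto_gainSlope_atBot (hp : p ∈ Set.Ioo 0 1) :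
    Tendsto (gainSlope p) (𝓝[>] 0) atBot := by
  obtain ⟨hs0, hs1⟩ := star_mem_Ioo hp (d := 0) ⟨le_rfl, zero_le_one⟩
  have hcont : ContinuousAt (fun d => (1 - 2 * p) * (Real.log (1 - star p d) -
      Real.log (star p d)) - Real.log (1 - d)) 0 := by
    have hstar := (continuous_star p).continuousAt (x := 0)
    exact (continuousAt_const.mul (((continuousAt_const.sub hstar).log (sub_pos.2 hs1).ne').sub
      (hstar.log hs0.ne'))).sub ((continuousAt_const.sub continuousAt_id).log (by simp))
  refine ((hcont.tendsto.mono_left nhdsWithin_le_nhds).add_atBot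
    Real.tendsto_log_nhdsGT_zero).congr fun d => ?_
  unfold gainSlope; ring

lemma tendsto_tangentGap_atTop (hp : p ∈ Set.Ioo 0 1) :
    Tendsto (tangentGap p) (𝓝[>] 0) atTop := by
  have hfactor : Tendsto (fun d => d - p) (𝓝[>] 0) (𝓝 (0 - p)) :=
    ((continuous_id.sub continuous_const).tendsto 0).mono_left nhdsWithin_le_nhds
  have hgain := ((continuous_gainNats p).neg.tendsto 0).mono_left
    (nhdsWithin_le_nhds (s := Set.Ioi 0))
  exact (((tendsto_gainSlope_atBot hp).atBot_mul_neg (by linarith [hp.1]) hfactor).atTop_add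
    hgain).congr fun d => (sub_eq_add_neg _ _).symm

lemma exists_tangentGap_eq_zero (hp : p ∈ Set.Ioo 0 1) (hne : p ≠ 1 / 2) :
    ∃ d ∈ Set.Ioo 0 p, tangentGap p d = 0 := by
  obtain ⟨d₀, hpos, hd₀⟩ := (((tendsto_tangentGap_atTop hp).eventually_gt_atTop 0).and
    (Ioo_mem_nhdsGT hp.1)).exists
  have hneg : tangentGap p p < 0 := by
    simpa [tangentGap] using gainNats_pos hp (Set.Ioo_subset_Icc_self hp) hne
  have hcont : ContinuousOn (tangentGap p) (Set.Icc d₀ p) :=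
    (continuousOn_tangentGap hp).mono fun d hd => ⟨hd₀.1.trans_le hd.1, hd.2.trans_lt hp.2⟩
  obtain ⟨d, hd, hzero⟩ := intermediate_value_Ioo' hd₀.2.le hcont ⟨hneg, hpos⟩
  exact ⟨d, ⟨hd₀.1.trans hd.1, hd.2⟩, hzero⟩

lemma isThreshold_iff (hp : p < 1) :
    IsThreshold p d ↔ d ∈ Set.Ioo 0 p ∧ tangentGap p d = 0 := by
  rw [IsThreshold, ← and_assoc]
  refine and_congr_right fun hd => ?_
  have hder : HasDerivAt (R1star p) (gainSlope p d / Real.log 2) d := by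
    rw [show R1star p = fun d => gainNats p d / Real.log 2 from funext (R1star_eq_gainNats_div p)]
    exact (hasDerivAt_gainNats ⟨hd.1.trans hd.2, hp⟩ ⟨hd.1, hd.2.trans hp⟩).div_const _
  have hslope : gainSlope p d / Real.log 2 = R1star p d / (d - p) ↔ tangentGap p d = 0 := by
    have hdp : d - p ≠ 0 := (sub_neg.2 hd.2).ne
    have hlog := log_two_pos.ne'
    rw [R1star_eq_gainNats_div, tangentGap, sub_eq_zero]
    field_simp
  rw [← hslope]
  exact ⟨hder.unique, fun h => h ▸ hder⟩

lemma existsUnique_isThreshold (hp : p ∈ Set.Ioo 0 1) (hne : p ≠ 1 / 2) :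
    ∃! D', IsThreshold p D' := by
  simp only [isThreshold_iff hp.2]
  obtain ⟨d, hd, hzero⟩ := exists_tangentGap_eq_zero hp hne
  exact ⟨d, ⟨hd, hzero⟩, fun e he => (strictAntiOn_tangentGap hp).injOn he.1 hd
    (he.2.trans hzero.symm)⟩

lemma IsThreshold.tangentGap_nonneg {D' : ℝ} (h : IsThreshold p D') (hp : p < 1)
    (hd : d ∈ Set.Ioc 0 D') : 0 ≤ tangentGap p d := by
  obtain ⟨hD', hzero⟩ := (isThreshold_iff hp).1 h
  rw [← hzero]
  exact (strictAntiOn_tangentGap ⟨hD'.1.trans hD'.2, hp⟩).antitoneOn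
    ⟨hd.1, hd.2.trans_lt hD'.2⟩ hD' hd.2

end Curve

/-! ### The rate region -/

section RateRegion

variable {p q D R₀ R₁ : ℝ}

lemma sum_zmod_two {M : Type*} [AddCommMonoid M] (f : ZMod 2 → M) : ∑ a, f a = f 0 + f 1 :=
  Fin.sum_univ_two f

lemma zmod_two_eq_zero_or_one : ∀ a : ZMod 2, a = 0 ∨ a = 1 := by decide

@[simp] lemma bern_zero (p : ℝ) : bern p 0 = 1 - p := by simp [bern]

@[simp] lemma bern_one (p : ℝ) : bern p 1 = p := by simp [bern]

lemma conv_bern (p q : ℝ) : conv (bern p) (bern q) = bern (star p q) := by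
  funext c
  rcases zmod_two_eq_zero_or_one c with rfl | rfl
  · have : (0 : ZMod 2) - 1 = 1 := by decide
    simp only [conv, sum_zmod_two, this, sub_zero, bern_zero, bern_one, star]; ring
  · simp only [conv, sum_zmod_two, sub_zero, sub_self, bern_zero, bern_one, star]; ring

lemma entropyBits_bern (p : ℝ) : entropyBits (bern p) = h2 p := by
  simp only [entropyBits, sum_zmod_two, bern_zero, bern_one, h2,
    Real.binEntropy_eq_negMulLog_add_negMulLog_one_sub]
  ring

lemma h2_nonneg (hp : p ∈ Set.Icc 0 1) : 0 ≤ h2 p :=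
  div_nonneg (Real.binEntropy_nonneg hp.1 hp.2) log_two_pos.le

lemma h2_le_one (p : ℝ) : h2 p ≤ 1 := by
  rw [h2, div_le_one log_two_pos]
  exact Real.binEntropy_le_log_two

lemma star_mem_Ioo_of_h2_lt (hp : p ∈ Set.Icc 0 1) (hq : q ∈ Set.Icc 0 1) (hD : D ∈ Set.Icc 0 1)
    (h : h2 (star p D) < h2 (star q D)) : star q D ∈ Set.Ioo 0 1 := by
  have hpos := (h2_nonneg (star_mem_Icc hp hD)).trans_lt h
  have hq' := star_mem_Icc hq hD
  refine ⟨hq'.1.lt_of_ne fun h0 => ?_, hq'.2.lt_of_ne fun h1 => ?_⟩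
  · simp [← h0, h2] at hpos
  · simp [h1, h2] at hpos

lemma mem_rateRegion : (R₀, R₁) ∈ rateRegion p q D ↔
    1 - h2 (star q D) < R₀ ∧ 1 - h2 D < R₀ + R₁ ∧ R₀ ≤ 1 - h2 (star p D) := by
  simp only [rateRegion, conv_bern, entropyBits_bern, Set.mem_ofPred_eq]

lemma exists_mem_rateRegion_lt (h : h2 (star p D) < h2 (star q D)) (hR : R1star p D < R₁) :
    ∃ R₀ : ℝ, (R₀, R₁) ∈ rateRegion p q D ∧ R₀ < 1 - h2 (star p D) := by
  have hroom : max (1 - h2 (star q D)) (1 - h2 D - R₁) < 1 - h2 (star p D) := by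
    unfold R1star at hR
    exact max_lt (by linarith) (by linarith)
  obtain ⟨R₀, hlower, hupper⟩ := exists_between hroom
  rw [max_lt_iff] at hlower
  exact ⟨R₀, mem_rateRegion.2 ⟨hlower.1, by linarith, hupper.le⟩, hupper⟩

lemma R1star_lt_of_mem_rateRegion (h : (R₀, R₁) ∈ rateRegion p q D) : R1star p D < R₁ := by
  obtain ⟨-, hsum, hR₀⟩ := mem_rateRegion.1 h
  unfold R1star
  linarith

lemma setOf_exists_mem_rateRegion (h : h2 (star p D) < h2 (star q D)) :
    {R₁ : ℝ | ∃ R₀ : ℝ, (R₀, R₁) ∈ rateRegion p q D} = Set.Ioi (R1star p D) :=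
  Set.Subset.antisymm (fun _ ⟨_, hR⟩ => R1star_lt_of_mem_rateRegion hR) fun _ hR =>
    (exists_mem_rateRegion_lt h hR).imp fun _ => And.left

lemma setOf_exists_mem_rateRegion_lt (h : h2 (star p D) < h2 (star q D)) :
    {R₁ : ℝ | ∃ R₀ : ℝ, (R₀, R₁) ∈ rateRegion p q D ∧ R₀ < 1 - h2 (star p D)} =
      Set.Ioi (R1star p D) :=
  Set.Subset.antisymm (fun _ ⟨_, hR, _⟩ => R1star_lt_of_mem_rateRegion hR) fun _ hR =>
    exists_mem_rateRegion_lt h hR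

lemma h2_star_lt_h2_star_half (hp : p ≠ 1 / 2) (hD : D ≠ 1 / 2) :
    h2 (star p D) < h2 (star (1 / 2) D) := by
  have hhalf : star (1 / 2) D = 2⁻¹ := by unfold star; ring
  have hne : star p D ≠ 2⁻¹ := one_div (2 : ℝ) ▸ star_ne_half hp hD
  rw [hhalf, h2, h2, Real.binEntropy_two_inv]
  exact div_lt_div_of_pos_right (Real.binEntropy_lt_log_two.2 hne) log_two_pos

end RateRegion

/-! ### Expectations over finite alphabets -/

section Expectation

open Classical in
/-- The indicator of a proposition, as a real number. -/
noncomputable def ind (P : Prop) : ℝ := if P then 1 else 0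

lemma ind_of {P : Prop} (h : P) : ind P = 1 := if_pos h

lemma ind_of_not {P : Prop} (h : ¬P) : ind P = 0 := if_neg h

lemma ind_nonneg (P : Prop) : 0 ≤ ind P := by unfold ind; split_ifs <;> norm_num

lemma ind_le_one (P : Prop) : ind P ≤ 1 := by unfold ind; split_ifs <;> norm_num

lemma ind_mono {P Q : Prop} (h : P → Q) : ind P ≤ ind Q := by
  by_cases hP : P
  · rw [ind_of hP, ind_of (h hP)]
  · rw [ind_of_not hP]; exact ind_nonneg Q

lemma ind_not (P : Prop) : ind (¬P) = 1 - ind P := by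
  by_cases hP : P <;> simp [ind, hP]

lemma ind_and (P Q : Prop) : ind (P ∧ Q) = ind P * ind Q := by
  by_cases hP : P <;> by_cases hQ : Q <;> simp [ind, hP, hQ]

lemma ind_or_le (P Q : Prop) : ind (P ∨ Q) ≤ ind P + ind Q := by
  by_cases hP : P <;> by_cases hQ : Q <;> simp [ind, hP, hQ]

lemma ind_exists_le_sum {ι : Type*} [Fintype ι] (P : ι → Prop) :
    ind (∃ i, P i) ≤ ∑ i, ind (P i) := by
  by_cases h : ∃ i, P i
  · obtain ⟨i, hi⟩ := h
    rw [ind_of ⟨i, hi⟩, ← ind_of hi]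
    exact Finset.single_le_sum (f := fun i => ind (P i)) (fun i _ => ind_nonneg (P i))
      (Finset.mem_univ i)
  · rw [ind_of_not h]
    exact Finset.sum_nonneg fun i _ => ind_nonneg (P i)

variable {A B ι : Type*} [Fintype A] [Fintype B] [Fintype ι]

/-- Expectation of `f` under the weights `w` on a finite alphabet. Product laws are handled by
iterating it. -/
noncomputable def expect (w : A → ℝ) (f : A → ℝ) : ℝ := ∑ a, w a * f a

/-- Probability of the event `E` under the weights `w`. -/
noncomputable def prob (w : A → ℝ) (E : A → Prop) : ℝ := expect w fun a => ind (E a)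

/-- The weights `w` form a probability law. -/
structure IsLaw (w : A → ℝ) : Prop where
  nonneg : ∀ a, 0 ≤ w a
  sum_eq_one : ∑ a, w a = 1

lemma expect_add (w f g : A → ℝ) :
    (expect w fun a => f a + g a) = expect w f + expect w g := by
  simp only [expect, mul_add, Finset.sum_add_distrib]

lemma expect_sub (w f g : A → ℝ) :
    (expect w fun a => f a - g a) = expect w f - expect w g := by
  simp only [expect, mul_sub, Finset.sum_sub_distrib]

lemma expect_const_mul (w : A → ℝ) (r : ℝ) (f : A → ℝ) :
    (expect w fun a => r * f a) = r * expect w f := by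
  simp only [expect, Finset.mul_sum, mul_left_comm]

lemma expect_mul_const (w f : A → ℝ) (r : ℝ) :
    (expect w fun a => f a * r) = expect w f * r := by
  simp only [expect, Finset.sum_mul, mul_assoc]

lemma expect_sum (w : A → ℝ) (f : ι → A → ℝ) :
    (expect w fun a => ∑ i, f i a) = ∑ i, expect w (f i) := by
  simp only [expect, Finset.mul_sum]
  exact Finset.sum_comm

lemma expect_comm (v : A → ℝ) (w : B → ℝ) (f : A → B → ℝ) :
    (expect v fun a => expect w (f a)) = expect w fun b => expect v fun a => f a b := by
  simp only [expect, Finset.mul_sum]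
  rw [Finset.sum_comm]
  simp only [mul_left_comm]

lemma expect_comp_equiv (w f : A → ℝ) (e : A ≃ A) (he : ∀ a, w (e a) = w a) :
    (expect w fun a => f (e a)) = expect w f := by
  rw [expect, expect, ← e.sum_comp fun a => w a * f a]
  simp only [he]

lemma prob_const_and (w : A → ℝ) (P : Prop) (E : A → Prop) :
    (prob w fun a => P ∧ E a) = ind P * prob w E := by
  simp only [prob, ind_and, expect_const_mul]

namespace IsLaw

variable {w : A → ℝ} {f g : A → ℝ} {E E' : A → Prop}

lemma expect_mono (hw : IsLaw w) (h : ∀ a, f a ≤ g a) : expect w f ≤ expect w g :=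
  Finset.sum_le_sum fun a _ => mul_le_mul_of_nonneg_left (h a) (hw.nonneg a)

lemma expect_nonneg (hw : IsLaw w) (h : ∀ a, 0 ≤ f a) : 0 ≤ expect w f :=
  Finset.sum_nonneg fun a _ => mul_nonneg (hw.nonneg a) (h a)

lemma expect_const (hw : IsLaw w) (r : ℝ) : (expect w fun _ => r) = r := by
  rw [expect, ← Finset.sum_mul, hw.sum_eq_one, one_mul]

lemma expect_le (hw : IsLaw w) {r : ℝ} (h : ∀ a, f a ≤ r) : expect w f ≤ r :=
  (hw.expect_mono h).trans_eq (hw.expect_const r)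

lemma nonempty (hw : IsLaw w) : Nonempty A := by
  by_contra h
  simpa [not_nonempty_iff.1 h] using hw.sum_eq_one

lemma exists_le_of_expect_le (hw : IsLaw w) {r : ℝ} (h : expect w f ≤ r) : ∃ a, f a ≤ r := by
  by_contra! hlt
  obtain ⟨a, ha⟩ : ∃ a, w a ≠ 0 := by
    by_contra! hzero
    simpa [hzero] using hw.sum_eq_one
  refine (h.trans_eq (hw.expect_const r).symm).not_gt (Finset.sum_lt_sum
    (fun b _ => mul_le_mul_of_nonneg_left (hlt b).le (hw.nonneg b)) ⟨a, Finset.mem_univ a, ?_⟩)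
  exact mul_lt_mul_of_pos_left (hlt a) ((hw.nonneg a).lt_of_ne' ha)

lemma prob_nonneg (hw : IsLaw w) (E : A → Prop) : 0 ≤ prob w E :=
  hw.expect_nonneg fun a => ind_nonneg (E a)

lemma prob_mono (hw : IsLaw w) (h : ∀ a, E a → E' a) : prob w E ≤ prob w E' :=
  hw.expect_mono fun a => ind_mono (h a)

lemma prob_mono_of_ne_zero (hw : IsLaw w) (h : ∀ a, w a ≠ 0 → E a → E' a) :
    prob w E ≤ prob w E' := by
  refine Finset.sum_le_sum fun a _ => ?_
  rcases eq_or_ne (w a) 0 with ha | ha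
  · rw [ha, zero_mul, zero_mul]
  · exact mul_le_mul_of_nonneg_left (ind_mono (h a ha)) (hw.nonneg a)

lemma prob_not (hw : IsLaw w) (E : A → Prop) : (prob w fun a => ¬E a) = 1 - prob w E := by
  simp only [prob, ind_not, expect_sub, hw.expect_const]

lemma prob_or_le (hw : IsLaw w) (E E' : A → Prop) :
    (prob w fun a => E a ∨ E' a) ≤ prob w E + prob w E' :=
  (hw.expect_mono fun a => ind_or_le (E a) (E' a)).trans_eq (expect_add _ _ _)

lemma prob_exists_le_sum (hw : IsLaw w) (E : ι → A → Prop) :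
    (prob w fun a => ∃ i, E i a) ≤ ∑ i, prob w (E i) :=
  (hw.expect_mono fun a => ind_exists_le_sum fun i => E i a).trans_eq (expect_sum _ _)

lemma prob_le_expect_div (hw : IsLaw w) (hf : ∀ a, 0 ≤ f a) {t : ℝ} (ht : 0 < t) :
    (prob w fun a => t ≤ f a) ≤ expect w f / t := by
  rw [div_eq_mul_inv, ← expect_mul_const]
  refine hw.expect_mono fun a => ?_
  rw [← div_eq_mul_inv]
  by_cases h : t ≤ f a
  · rwa [ind_of h, one_le_div ht]
  · rw [ind_of_not h]
    exact div_nonneg (hf a) ht.le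

lemma expect_sq_sub (hw : IsLaw w) (f : A → ℝ) (r : ℝ) :
    (expect w fun a => (f a - r) ^ 2) =
      (expect w fun a => f a ^ 2) - 2 * r * expect w f + r ^ 2 := by
  simp only [sub_sq, expect_add, expect_sub, hw.expect_const, mul_right_comm _ _ r,
    expect_const_mul]

end IsLaw

/-! ### Product laws -/

/-- The law of a pair of independent variables of laws `v` and `w`. -/
noncomputable def prodLaw (v : A → ℝ) (w : B → ℝ) (s : A × B) : ℝ := v s.1 * w s.2

lemma expect_prodLaw (v : A → ℝ) (w : B → ℝ) (f : A × B → ℝ) :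
    expect (prodLaw v w) f = expect v fun a => expect w fun b => f (a, b) := by
  simp only [expect, prodLaw, Fintype.sum_prod_type, Finset.mul_sum, mul_assoc]

lemma IsLaw.prod {v : A → ℝ} {w : B → ℝ} (hv : IsLaw v) (hw : IsLaw w) :
    IsLaw (prodLaw v w) where
  nonneg s := mul_nonneg (hv.nonneg s.1) (hw.nonneg s.2)
  sum_eq_one := by
    simp only [prodLaw, Fintype.sum_prod_type, ← Finset.mul_sum, hw.sum_eq_one, mul_one,
      hv.sum_eq_one]

/-- The law of a family, indexed by `ι`, of independent variables of law `w`. -/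
noncomputable def piLaw (w : A → ℝ) (c : ι → A) : ℝ := ∏ i, w (c i)

variable [DecidableEq ι] {w : A → ℝ}

lemma expect_piLaw_prod (w : A → ℝ) (f : ι → A → ℝ) :
    (expect (piLaw w) fun c => ∏ i, f i (c i)) = ∏ i, expect w (f i) := by
  simp only [expect, piLaw, ← Finset.prod_mul_distrib]
  exact (Fintype.prod_sum fun i a => w a * f i a).symm

namespace IsLaw

lemma pi (hw : IsLaw w) : IsLaw (piLaw w : (ι → A) → ℝ) where
  nonneg c := Finset.prod_nonneg fun i _ => hw.nonneg (c i)
  sum_eq_one := by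
    simpa [expect, hw.sum_eq_one] using expect_piLaw_prod w fun (_ : ι) _ => 1

lemma expect_piLaw_apply (hw : IsLaw w) (i : ι) (f : A → ℝ) :
    (expect (piLaw w) fun c => f (c i)) = expect w f := by
  have h := expect_piLaw_prod w fun k a => if k = i then f a else 1
  rw [Finset.prod_eq_single i (fun k _ hk => by simp only [hk, if_false, hw.expect_const])
    (by simp)] at h
  simpa only [Finset.prod_ite_eq', Finset.mem_univ, if_true] using h

lemma expect_piLaw_mul_apply (hw : IsLaw w) {i j : ι} (hij : i ≠ j) (f g : A → ℝ) :
    (expect (piLaw w) fun c => f (c i) * g (c j)) = expect w f * expect w g := by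
  have h := expect_piLaw_prod w fun k a => if k = i then f a else if k = j then g a else 1
  rw [Finset.prod_eq_mul i j hij (fun k _ hk => by
    simp only [hk.1, hk.2, if_false, hw.expect_const]) (by simp) (by simp)] at h
  simp only [if_true, hij.symm, if_false] at h
  rw [← h]
  congr 1 with c
  rw [Finset.prod_eq_mul i j hij (fun k _ hk => by simp only [hk.1, hk.2, if_false]) (by simp)
    (by simp)]
  simp only [if_true, hij.symm, if_false]

lemma expect_piLaw_sum (hw : IsLaw w) (f : ι → A → ℝ) :
    (expect (piLaw w) fun c => ∑ i, f i (c i)) = ∑ i, expect w (f i) := by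
  simp only [expect_sum, hw.expect_piLaw_apply]

lemma expect_piLaw_sq_sum (hw : IsLaw w) {f : ι → A → ℝ} (hf : ∀ i, expect w (f i) = 0) :
    (expect (piLaw w) fun c => (∑ i, f i (c i)) ^ 2) =
      ∑ i, expect w fun a => f i a ^ 2 := by
  simp only [sq, Finset.sum_mul_sum, expect_sum]
  refine Finset.sum_congr rfl fun i _ => ?_
  rw [Finset.sum_eq_single i (fun j _ hj => by
    rw [hw.expect_piLaw_mul_apply hj.symm, hf i, zero_mul]) (by simp)]
  exact hw.expect_piLaw_apply i fun a => f i a * f i a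

lemma prob_le_abs_sub_le (hw : IsLaw w) (f : ι → A → ℝ) (hf : ∀ i a, |f i a| ≤ 1) {t : ℝ}
    (ht : 0 < t) :
    (prob (piLaw w) fun c => t ≤ |∑ i, f i (c i) - ∑ i, expect w (f i)|) ≤
      Fintype.card ι / t ^ 2 := by
  have hcentred : ∀ i, (expect w fun a => f i a - expect w (f i)) = 0 := fun i => by
    rw [expect_sub, hw.expect_const, sub_self]
  have hvar : ∀ i, (expect w fun a => (f i a - expect w (f i)) ^ 2) ≤ 1 := fun i => by
    have hsq : (expect w fun a => f i a ^ 2) ≤ 1 :=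
      hw.expect_le fun a => (sq_le_one_iff_abs_le_one _).2 (hf i a)
    rw [hw.expect_sq_sub]
    linarith [sq_nonneg (expect w (f i))]
  calc (prob (piLaw w) fun c => t ≤ |∑ i, f i (c i) - ∑ i, expect w (f i)|)
      ≤ prob (piLaw w) fun c =>
          t ^ 2 ≤ (∑ i, (f i (c i) - expect w (f i))) ^ 2 := hw.pi.prob_mono fun c hc => by
        rw [Finset.sum_sub_distrib, ← sq_abs (∑ i, f i (c i) - _)]
        exact pow_le_pow_left₀ ht.le hc 2
    _ ≤ (∑ i, expect w fun a => (f i a - expect w (f i)) ^ 2) / t ^ 2 := by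
        rw [← hw.expect_piLaw_sq_sum hcentred]
        exact hw.pi.prob_le_expect_div (fun c => sq_nonneg _) (by positivity)
    _ ≤ Fintype.card ι / t ^ 2 := by
        gcongr
        exact (Finset.sum_le_card_nsmul _ _ 1 fun i _ => hvar i).trans_eq (by simp)

end IsLaw

end Expectation

/-! ### Words and likelihoods -/

section Words

variable {n : ℕ} {p q r : ℝ}

lemma isLaw_bern (hp : p ∈ Set.Icc 0 1) : IsLaw (bern p) where
  nonneg a := by unfold bern; split_ifs <;> linarith [hp.1, hp.2]
  sum_eq_one := by rw [sum_zmod_two, bern_zero, bern_one, sub_add_cancel]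

lemma half_mem_Icc : (1 / 2 : ℝ) ∈ Set.Icc 0 1 := by norm_num

lemma bern_half (a : ZMod 2) : bern (1 / 2) a = 1 / 2 := by
  unfold bern; split_ifs <;> norm_num

lemma additiveLaw_eq (N : ZMod 2 → ℝ) (a b : ZMod 2) : additiveLaw N a b = 1 / 2 * N (b - a) := by
  rw [additiveLaw, bern_half]

/-- The uniform law on words. -/
noncomputable def uniform (n : ℕ) : Word n → ℝ := piLaw (bern (1 / 2))

lemma isLaw_uniform (n : ℕ) : IsLaw (uniform n) := (isLaw_bern half_mem_Icc).pi

lemma uniform_apply (u : Word n) : uniform n u = (1 / 2) ^ n := by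
  simp only [uniform, piLaw, bern_half, Finset.prod_const, Finset.card_univ, Fintype.card_fin]

lemma expect_uniform_comp (f : Word n → ℝ) (e : Word n ≃ Word n) :
    (expect (uniform n) fun u => f (e u)) = expect (uniform n) f :=
  expect_comp_equiv _ _ e fun u => by rw [uniform_apply, uniform_apply]

lemma prob_uniform_comp (E : Word n → Prop) (e : Word n ≃ Word n) :
    (prob (uniform n) fun u => E (e u)) = prob (uniform n) E :=
  expect_uniform_comp (fun u => ind (E u)) e

lemma hammingDist_eq_sum_ind (x y : Word n) :
    (hammingDist x y : ℝ) = ∑ k, ind (x k ≠ y k) := by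
  simp only [hammingDist, ind, Finset.card_filter]
  push_cast
  exact Finset.sum_congr rfl fun k _ => by congr

lemma hammingNorm_eq_sum_ind (w : Word n) : (hammingNorm w : ℝ) = ∑ k, ind (w k ≠ 0) := by
  simp only [← hammingDist_zero_right, hammingDist_eq_sum_ind, Pi.zero_apply]

lemma piLaw_bern (w : Word n) :
    piLaw (bern r) w = (1 - r) ^ (n - hammingNorm w) * r ^ hammingNorm w := by
  have hcard : (Finset.univ.filter fun k => w k = 0).card = n - hammingNorm w := by
    have h := Finset.card_filter_add_card_filter_not (s := Finset.univ) fun k => w k = 0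
    rw [Finset.card_univ, Fintype.card_fin] at h
    exact Nat.eq_sub_of_add_eq h
  simp only [piLaw, bern, Finset.prod_ite, Finset.prod_const, hcard, hammingNorm]

lemma piLaw_bern_eq_exp (hr : r ∈ Set.Ico 0 1) (w : Word n) (hw : r = 0 → w = 0) :
    piLaw (bern r) w =
      Real.exp (n * Real.log (1 - r) + hammingNorm w * (Real.log r - Real.log (1 - r))) := by
  have hle : hammingNorm w ≤ n := by simpa using hammingNorm_le_card_fintype (x := w)
  have hr1 : 0 < 1 - r := sub_pos.2 hr.2
  rw [piLaw_bern]
  rcases hr.1.eq_or_lt' with rfl | hr0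
  · simp [hw rfl]
  · rw [← Real.exp_log (pow_pos hr1 _), ← Real.exp_log (pow_pos hr0 _), ← Real.exp_add,
      Real.log_pow, Real.log_pow, Nat.cast_sub hle]
    ring_nf

/-- `ε₀` is a tolerance on the fraction of ones of a word within which its probability under
`B(r)` is `2 ^ (-n (H(r) ± δ))`. For `r = 0` this only concerns the zero word. -/
def LikelihoodTolerance (r δ ε₀ : ℝ) : Prop :=
  ∀ (n : ℕ) (w : Word n), (r = 0 → w = 0) → |hammingNorm w - n * r| ≤ n * ε₀ →
    (2 : ℝ) ^ (-(n * (h2 r + δ))) ≤ piLaw (bern r) w ∧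
      piLaw (bern r) w ≤ (2 : ℝ) ^ (-(n * (h2 r - δ)))

lemma exists_likelihoodTolerance {δ : ℝ} (hr : r ∈ Set.Ico 0 1) (hδ : 0 < δ) :
    ∃ ε₀ : ℝ, 0 < ε₀ ∧ LikelihoodTolerance r δ ε₀ := by
  have hlog := log_two_pos
  set L := Real.log r - Real.log (1 - r) with hL
  refine ⟨δ * Real.log 2 / (|L| + 1), by positivity, fun n w hw hdev => ?_⟩
  have hexponent : n * Real.log (1 - r) + hammingNorm w * L =
      -(n * (h2 r * Real.log 2)) + (hammingNorm w - n * r) * L := by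
    rw [h2, div_mul_cancel₀ _ hlog.ne', Real.binEntropy_eq_negMulLog_add_negMulLog_one_sub, hL]
    simp only [Real.negMulLog]; ring
  have herror : |(hammingNorm w - n * r) * L| ≤ n * (δ * Real.log 2) := calc
    |(hammingNorm w - n * r) * L| ≤ n * (δ * Real.log 2 / (|L| + 1)) * |L| := by
      rw [abs_mul]; gcongr
    _ = n * (δ * Real.log 2) * (|L| / (|L| + 1)) := by ring
    _ ≤ n * (δ * Real.log 2) := mul_le_of_le_one_right (by positivity)
      ((div_le_one (by positivity)).2 (by linarith))
  rw [abs_le] at herror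
  simp only [piLaw_bern_eq_exp hr w hw, Real.rpow_def_of_pos two_pos, Real.exp_le_exp]
  rw [hexponent]
  constructor <;> linarith

end Words

/-! ### Empirical frequencies -/

section Frequencies

variable {n : ℕ} {A : Type*} [Fintype A] {w : A → ℝ}

/-- All counts of pairs of symbols in `(u, v)` are within `n δ` of `n P`: strong typicality
without its condition on pairs of symbols of probability zero. -/
def PairFreqNear (δ : ℝ) (P : ZMod 2 → ZMod 2 → ℝ) (u v : Word n) : Prop :=
  ∀ a b, |(pairCount u v a b : ℝ) - n * P a b| < n * δ

lemma jointlyTypical_iff (hn : 0 < n) {ε : ℝ} {P : ZMod 2 → ZMod 2 → ℝ} {u v : Word n} :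
    JointlyTypical ε P u v ↔
      (∀ a b, P a b = 0 → pairCount u v a b = 0) ∧ PairFreqNear (ε / 4) P u v := by
  have hn' : (0 : ℝ) < n := Nat.cast_pos.2 hn
  have hscale : ∀ c x : ℝ, |c / n - x| < ε / 4 ↔ |c - n * x| < n * (ε / 4) := fun c x => by
    rw [show c - n * x = n * (c / n - x) by field_simp, abs_mul, abs_of_pos hn',
      mul_lt_mul_iff_right₀ hn']
  simp only [JointlyTypical, PairFreqNear, hscale, forall_and]

lemma pairCount_eq_sum_ind (u v : Word n) (a b : ZMod 2) :
    (pairCount u v a b : ℝ) = ∑ k, ind (u k = a ∧ v k = b) := by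
  simp only [pairCount, ind, Finset.card_filter]
  push_cast
  exact Finset.sum_congr rfl fun k _ => by congr

lemma pairCount_sub_left (u v : Word n) (a b : ZMod 2) :
    pairCount u (v - u) a (b - a) = pairCount u v a b := by
  unfold pairCount
  congr 1
  exact Finset.filter_congr fun k _ => and_congr_right fun hk => by
    rw [Pi.sub_apply, hk, sub_left_inj]

lemma pairCount_comm (u v : Word n) (a b : ZMod 2) : pairCount u v a b = pairCount v u b a := by
  simp only [pairCount, and_comm]

lemma pairFreqNear_additiveLaw_iff {δ : ℝ} {N : ZMod 2 → ℝ} {u v : Word n} :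
    PairFreqNear δ (additiveLaw N) u v ↔ PairFreqNear δ (fun _ s => 1 / 2 * N s) u (v - u) := by
  simp only [PairFreqNear, additiveLaw_eq]
  refine forall_congr' fun a => ⟨fun h s => ?_, fun h b => ?_⟩
  · simpa only [← pairCount_sub_left u v, add_sub_cancel_right] using h (s + a)
  · simpa only [pairCount_sub_left] using h (b - a)

lemma pairFreqNear_comm {δ : ℝ} {P : ZMod 2 → ZMod 2 → ℝ} {u v : Word n} :
    PairFreqNear δ P u v ↔ PairFreqNear δ (fun a b => P b a) v u := by
  simp only [PairFreqNear, pairCount_comm u v]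
  exact forall_comm

lemma natCast_mul_div_sq (n : ℕ) (t : ℝ) : (n : ℝ) / (n * t) ^ 2 = 1 / (n * t ^ 2) := by
  rcases Nat.eq_zero_or_pos n with rfl | hn
  · simp
  · have : (n : ℝ) ≠ 0 := (Nat.cast_pos.2 hn).ne'
    rcases eq_or_ne t 0 with rfl | ht
    · simp
    · field_simp

lemma IsLaw.prob_not_pairFreqNear_le (hw : IsLaw w) (hn : 0 < n) {δ δ' : ℝ} (hδ : δ < δ')
    {P : ZMod 2 → ZMod 2 → ℝ} (U V : Fin n → A → ZMod 2)
    (hmean : ∀ a b, |∑ k, (prob w fun c => U k c = a ∧ V k c = b) - n * P a b| ≤ n * δ) :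
    (prob (piLaw w) fun c => ¬PairFreqNear δ' P (fun k => U k (c k)) fun k => V k (c k)) ≤
      4 / (n * (δ' - δ) ^ 2) := by
  have hn' : (0 : ℝ) < n := Nat.cast_pos.2 hn
  set S : ZMod 2 → ZMod 2 → ℝ := fun a b => ∑ k, prob w fun c => U k c = a ∧ V k c = b
  have hdeviation : ∀ a b, (prob (piLaw w) fun c => n * (δ' - δ) ≤
      |∑ k, ind (U k (c k) = a ∧ V k (c k) = b) - S a b|) ≤ 1 / (n * (δ' - δ) ^ 2) :=
    fun a b => by
      simpa only [Fintype.card_fin, natCast_mul_div_sq, S, prob] using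
        hw.prob_le_abs_sub_le (fun k c => ind (U k c = a ∧ V k c = b))
          (fun k c => (abs_of_nonneg (ind_nonneg _)).trans_le (ind_le_one _))
          (mul_pos hn' (sub_pos.2 hδ))
  calc (prob (piLaw w) fun c => ¬PairFreqNear δ' P (fun k => U k (c k)) fun k => V k (c k))
      ≤ prob (piLaw w) fun c => ∃ ab : ZMod 2 × ZMod 2, n * (δ' - δ) ≤
          |∑ k, ind (U k (c k) = ab.1 ∧ V k (c k) = ab.2) - S ab.1 ab.2| := by
        refine hw.pi.prob_mono fun c hc => ?_
        simp only [PairFreqNear, not_forall, not_lt, pairCount_eq_sum_ind] at hc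
        obtain ⟨a, b, hab⟩ := hc
        have htriangle :=
          abs_sub_le (∑ k, ind (U k (c k) = a ∧ V k (c k) = b)) (S a b) (n * P a b)
        exact ⟨(a, b), by linarith [hmean a b]⟩
    _ ≤ ∑ _ab : ZMod 2 × ZMod 2, 1 / (n * (δ' - δ) ^ 2) :=
        (hw.pi.prob_exists_le_sum _).trans (Finset.sum_le_sum fun ab _ => hdeviation ab.1 ab.2)
    _ = 4 / (n * (δ' - δ) ^ 2) := by
        rw [Finset.sum_const, Finset.card_univ, Fintype.card_prod, ZMod.card, nsmul_eq_mul,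
          mul_one_div]
        norm_num

lemma PairFreqNear.prob_not_sub_le {N : ZMod 2 → ℝ} (hN : IsLaw N) (hn : 0 < n) {δ δ' : ℝ}
    (hδ : δ < δ') {P : ZMod 2 → ZMod 2 → ℝ} {u v : Word n} (h : PairFreqNear δ P u v) :
    (prob (piLaw N) fun c : Word n =>
      ¬PairFreqNear δ' (fun a b => expect N fun c => P (a + c) b) (u - c) v) ≤
      4 / (n * (δ' - δ) ^ 2) := by
  refine hN.prob_not_pairFreqNear_le hn hδ (fun k c => u k - c) (fun k _ => v k) fun a b => ?_
  have hmean : ∑ k, (prob N fun c => u k - c = a ∧ v k = b) =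
      expect N fun c => (pairCount u v (a + c) b : ℝ) := by
    simp only [prob, ← expect_sum, sub_eq_iff_eq_add, pairCount_eq_sum_ind]
  rw [hmean, ← expect_const_mul, ← expect_sub, abs_le]
  constructor
  · rw [← hN.expect_const (-(n * δ))]
    exact hN.expect_mono fun c => (abs_lt.1 (h (a + c) b)).1.le
  · exact hN.expect_le fun c => (abs_lt.1 (h (a + c) b)).2.le

/-- Both symbols occur in `x` with frequency within `δ` of `1 / 2`. -/
def Balanced (δ : ℝ) (x : Word n) : Prop := PairFreqNear δ (fun a b => 1 / 2 * ind (a = b)) x x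

lemma prob_not_balanced_le (hn : 0 < n) {δ : ℝ} (hδ : 0 < δ) :
    (prob (uniform n) fun x => ¬Balanced δ x) ≤ 4 / (n * δ ^ 2) := by
  have h := (isLaw_bern half_mem_Icc).prob_not_pairFreqNear_le hn hδ
    (P := fun a b => 1 / 2 * ind (a = b)) (fun _ a => a) (fun _ a => a) fun a b => by
      have hletter : (prob (bern (1 / 2)) fun c => c = a ∧ c = b) = 1 / 2 * ind (a = b) := by
        simp only [prob, expect, bern_half, ← Finset.mul_sum, ind_and]
        rw [Finset.sum_eq_single a (fun c _ hc => by rw [ind_of_not hc, zero_mul]) (by simp),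
          ind_of rfl, one_mul]
      simp only [hletter, Finset.sum_const, Finset.card_univ, Fintype.card_fin, nsmul_eq_mul,
        sub_self, abs_zero, mul_zero, le_refl]
  rwa [sub_zero] at h

lemma Balanced.prob_not_jointlyTypical_le (hn : 0 < n) {D ε : ℝ} (hD : D ∈ Set.Icc 0 1)
    (hε : 0 < ε) {x : Word n} (hx : Balanced (ε / 8) x) :
    (prob (piLaw (bern D)) fun s : Word n =>
      ¬JointlyTypical ε (additiveLaw (bern D)) (x - s) x) ≤ 4 / (n * (ε / 8) ^ 2) := by
  have hlaw : (fun a b => expect (bern D) fun c => 1 / 2 * ind (a + c = b)) =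
      additiveLaw (bern D) := by
    funext a b
    rw [expect_const_mul, additiveLaw_eq, expect,
      Finset.sum_eq_single (b - a) (fun c _ hc => ?_) (by simp),
      ind_of (add_sub_cancel a b), mul_one]
    rw [ind_of_not fun h => hc (eq_sub_of_add_eq' h), mul_zero]
  have h := hx.prob_not_sub_le (isLaw_bern hD) hn (show ε / 8 < ε / 4 by linarith)
  rw [hlaw, show ε / 4 - ε / 8 = ε / 8 by ring] at h
  refine ((isLaw_bern hD).pi.prob_mono_of_ne_zero fun s hs htyp hnear => htyp ?_).trans h
  refine (jointlyTypical_iff hn).2 ⟨fun a b hab => ?_, hnear⟩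
  have hs' : ∀ k, bern D (s k) ≠ 0 := fun k => Finset.prod_ne_zero_iff.1 hs k (Finset.mem_univ k)
  rw [pairCount, Finset.card_eq_zero, Finset.filter_eq_empty_iff]
  rintro k - ⟨ha, hb⟩
  refine hs' k ?_
  rw [additiveLaw_eq, ← ha, ← hb, Pi.sub_apply, sub_sub_cancel] at hab
  linarith

variable {D δ δ' : ℝ} {u v m : Word n}

lemma PairFreqNear.abs_hammingNorm_sub_le
    (h : PairFreqNear δ (fun _ s => 1 / 2 * bern D s) u m) :
    |hammingNorm m - n * D| ≤ n * (2 * δ) := by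
  have hones : (hammingNorm m : ℝ) = pairCount u m 0 1 + pairCount u m 1 1 := by
    rw [hammingNorm_eq_sum_ind, pairCount_eq_sum_ind, pairCount_eq_sum_ind,
      ← Finset.sum_add_distrib]
    refine Finset.sum_congr rfl fun k _ => ?_
    rcases zmod_two_eq_zero_or_one (u k) with hu | hu <;>
      rcases zmod_two_eq_zero_or_one (m k) with hm | hm <;> simp [ind, hu, hm]
  have h₀ := abs_lt.1 (h 0 1)
  have h₁ := abs_lt.1 (h 1 1)
  simp only [bern_one] at h₀ h₁
  rw [hones, abs_le]
  constructor <;> linarith [h₀.1, h₀.2, h₁.1, h₁.2]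

lemma JointlyTypical.eq_of_noiseless {ε : ℝ} (h : JointlyTypical ε (additiveLaw (bern 0)) u v) :
    v = u := by
  funext k
  by_contra hne
  have hsub : v k - u k = 1 :=
    (zmod_two_eq_zero_or_one _).resolve_left (sub_ne_zero.2 hne)
  have hcount := (h (u k) (v k)).1 (by rw [additiveLaw_eq, hsub, bern_one, mul_zero])
  rw [pairCount, Finset.card_eq_zero, Finset.filter_eq_empty_iff] at hcount
  exact hcount (Finset.mem_univ k) ⟨rfl, rfl⟩

lemma JointlyTypical.pairFreqNear_sub (hn : 0 < n) {ε : ℝ} {N : ZMod 2 → ℝ}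
    (h : JointlyTypical ε (additiveLaw N) u v) :
    PairFreqNear (ε / 4) (fun _ s => 1 / 2 * N s) u (v - u) :=
  pairFreqNear_additiveLaw_iff.1 ((jointlyTypical_iff hn).1 h).2

lemma JointlyTypical.piLaw_bern_sub_bounds {r ε ε₀ : ℝ} (hr : LikelihoodTolerance r δ ε₀)
    (hn : 0 < n) (hε : ε / 2 ≤ ε₀) (h : JointlyTypical ε (additiveLaw (bern r)) u v) :
    (2 : ℝ) ^ (-(n * (h2 r + δ))) ≤ piLaw (bern r) (v - u) ∧
      piLaw (bern r) (v - u) ≤ (2 : ℝ) ^ (-(n * (h2 r - δ))) := by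
  refine hr n _ (fun h0 => sub_eq_zero.2 (h0 ▸ h).eq_of_noiseless)
    ((h.pairFreqNear_sub hn).abs_hammingNorm_sub_le.trans ?_)
  gcongr
  linarith

lemma PairFreqNear.prob_not_sub_left_le {N Q : ZMod 2 → ℝ} (hQ : IsLaw Q) (hn : 0 < n)
    (hδ : δ < δ') (h : PairFreqNear δ (fun _ s => N s) u m) :
    (prob (piLaw Q) fun c : Word n => ¬PairFreqNear δ' (fun _ s => N s) (u - c) m) ≤
      4 / (n * (δ' - δ) ^ 2) := by
  simpa only [hQ.expect_const] using h.prob_not_sub_le hQ hn hδ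

lemma PairFreqNear.prob_not_sub_right_le {N Q : ZMod 2 → ℝ} (hQ : IsLaw Q) (hn : 0 < n)
    (hδ : δ < δ') (h : PairFreqNear δ (fun _ s => 1 / 2 * N s) u m) :
    (prob (piLaw Q) fun c : Word n =>
      ¬PairFreqNear δ' (fun _ s => 1 / 2 * conv Q N s) u (m - c)) ≤ 4 / (n * (δ' - δ) ^ 2) := by
  have hconv : ∀ s, (expect Q fun c => 1 / 2 * N (s + c)) = 1 / 2 * conv Q N s := fun s => by
    rw [expect_const_mul]
    simp only [expect, conv, CharTwo.sub_eq_add]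
  simpa only [hconv, pairFreqNear_comm (v := u)] using
    (pairFreqNear_comm.1 h).prob_not_sub_le hQ hn hδ

end Frequencies

/-! ### The converse -/

section Converse

open Real

variable {A B C A' B' C' M : Type*} [Fintype A] [Fintype B] [Fintype A'] [Fintype B'] [Fintype M]

/-- The converse inequality for a channel `W` with a distortion measure `ρ`: when an input is
guessed from the output, the conditional entropies and the distortion satisfy
`H(output) - H(input) + E ρ ≥ r`. It is homogeneous in the weights `μ` of the input, so that it can
be applied to the part of the input that is sent with a given message. -/
def ConverseBound (W : A → B → ℝ) (ρ : A → C → ℝ) (r : ℝ) : Prop :=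
  ∀ μ : A → ℝ, (∀ x, 0 ≤ μ x) → ∀ f : B → C,
    r * ∑ x, μ x ≤ ∑ y, negMulLog (∑ x, μ x * W x y) - ∑ x, negMulLog (μ x) +
      ∑ x, ∑ y, μ x * W x y * ρ x (f y)

lemma sum_prod_distortion (μ : A × A' → ℝ) (W : A → B → ℝ) (W' : A' → B' → ℝ)
    (g : A → B × B' → ℝ) (g' : A' → B × B' → ℝ) :
    ∑ s : A × A', ∑ t : B × B', μ s * (W s.1 t.1 * W' s.2 t.2) * (g s.1 t + g' s.2 t) =
      ∑ y', ∑ x, ∑ y, (∑ x', μ (x, x') * W' x' y') * W x y * g x (y, y') +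
        ∑ x, expect (W x) fun y => ∑ x', ∑ y', μ (x, x') * W' x' y' * g' x' (y, y') := by
  simp only [mul_add, Finset.sum_add_distrib]
  congr 1
  · rw [Finset.sum_comm, Fintype.sum_prod_type_right]
    simp only [Fintype.sum_prod_type, Finset.sum_mul]
    refine Finset.sum_congr rfl fun y' _ => ?_
    rw [Finset.sum_comm]
    exact Finset.sum_congr rfl fun x _ => Finset.sum_congr rfl fun y _ =>
      Finset.sum_congr rfl fun x' _ => by ring
  · simp only [expect, Fintype.sum_prod_type, Finset.mul_sum]
    refine Finset.sum_congr rfl fun x _ => ?_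
    rw [Finset.sum_comm]
    exact Finset.sum_congr rfl fun y _ => Finset.sum_congr rfl fun x' _ =>
      Finset.sum_congr rfl fun y' _ => by ring

/-- Each output pair is treated as two single outputs: the first inequality is applied with the
second output given, the second inequality with the first input and the first output given. -/
lemma ConverseBound.prod {W : A → B → ℝ} {ρ : A → C → ℝ} {r : ℝ} {W' : A' → B' → ℝ}
    {ρ' : A' → C' → ℝ} {r' : ℝ} (h : ConverseBound W ρ r) (h' : ConverseBound W' ρ' r')
    (hW : ∀ x, IsLaw (W x)) (hW' : ∀ x, IsLaw (W' x)) :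
    ConverseBound (fun (x : A × A') (y : B × B') => W x.1 y.1 * W' x.2 y.2)
      (fun x (z : C × C') => ρ x.1 z.1 + ρ' x.2 z.2) (r + r') := by
  intro μ hμ f
  let κ : B' → A → ℝ := fun y' x => ∑ x', μ (x, x') * W' x' y'
  have hκ : ∀ y' x, 0 ≤ κ y' x := fun y' x =>
    Finset.sum_nonneg fun x' _ => mul_nonneg (hμ _) ((hW' x').nonneg y')
  have hmass : ∑ y', ∑ x, κ y' x = ∑ x, ∑ x', μ (x, x') := by
    rw [Finset.sum_comm]
    refine Finset.sum_congr rfl fun x _ => ?_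
    rw [Finset.sum_comm]
    simp only [← Finset.mul_sum, (hW' _).sum_eq_one, mul_one]
  have hout : ∑ t : B × B', negMulLog (∑ s : A × A', μ s * (W s.1 t.1 * W' s.2 t.2)) =
      ∑ y', ∑ y, negMulLog (∑ x, κ y' x * W x y) := by
    rw [Fintype.sum_prod_type_right]
    simp only [κ, Fintype.sum_prod_type, Finset.sum_mul, mul_right_comm _ (W' _ _), mul_assoc]
  have hfirst := Finset.sum_le_sum fun (y' : B') (_ : y' ∈ Finset.univ) =>
    h (κ y') (hκ y') fun y => (f (y, y')).1
  have hsecond := Finset.sum_le_sum fun (x : A) (_ : x ∈ Finset.univ) =>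
    (hW x).expect_mono fun y => h' (fun x' => μ (x, x')) (fun x' => hμ _) fun y' => (f (y, y')).2
  simp only [expect_add, (hW _).expect_const, Finset.sum_add_distrib, Finset.sum_sub_distrib,
    ← Finset.mul_sum] at hsecond
  simp only [Finset.sum_add_distrib, Finset.sum_sub_distrib, ← Finset.mul_sum, hmass] at hfirst
  rw [Finset.sum_comm (f := fun y' x => negMulLog (κ y' x))] at hfirst
  rw [hout, sum_prod_distortion μ W W' (fun x t => ρ x (f t).1) fun x' t => ρ' x' (f t).2,
    Fintype.sum_prod_type μ, Fintype.sum_prod_type fun s => negMulLog (μ s)]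
  linarith

lemma sum_negMulLog_le [Nonempty M] {g : M → ℝ} (hg : ∀ m, 0 ≤ g m) :
    ∑ m, negMulLog (g m) ≤ (∑ m, g m) * log (Fintype.card M) + negMulLog (∑ m, g m) := by
  have hM : (0 : ℝ) < Fintype.card M := Nat.cast_pos.2 Fintype.card_pos
  have hJensen := concaveOn_negMulLog.le_map_sum (t := Finset.univ)
    (w := fun _ : M => (Fintype.card M : ℝ)⁻¹) (p := g) (fun _ _ => by positivity)
    (by simp [hM.ne']) fun m _ => hg m
  simp only [smul_eq_mul, ← Finset.mul_sum] at hJensen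
  rw [inv_mul_le_iff₀ hM, negMulLog_mul, mul_add, negMulLog, log_inv] at hJensen
  refine hJensen.trans_eq ?_
  field_simp

lemma sum_negMulLog_output_le [Nonempty M] {W : A → B → ℝ} (hW : ∀ x, IsLaw (W x)) {P : A → ℝ}
    (hP : IsLaw P) {μ : M → A → ℝ} (hμ : ∀ m x, 0 ≤ μ m x) (hsum : ∀ x, ∑ m, μ m x = P x) :
    ∑ m, ∑ y, negMulLog (∑ x, μ m x * W x y) ≤
      log (Fintype.card M) + ∑ y, negMulLog (expect P fun x => W x y) := by
  have hsplit : ∀ y, ∑ m, ∑ x, μ m x * W x y = expect P fun x => W x y := fun y => by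
    rw [Finset.sum_comm]
    simp only [← Finset.sum_mul, hsum, expect]
  have htotal : ∑ y, (expect P fun x => W x y) = 1 := by
    simp only [← expect_sum, (hW _).sum_eq_one, hP.expect_const]
  rw [Finset.sum_comm, ← one_mul (log _), ← htotal, Finset.sum_mul, ← Finset.sum_add_distrib]
  refine Finset.sum_le_sum fun y _ => ?_
  rw [← hsplit]
  exact sum_negMulLog_le fun m => Finset.sum_nonneg fun x _ =>
    mul_nonneg (hμ m x) ((hW x).nonneg y)

/-- The bound is applied to each part of the input with a given message, and the output entropies
of the parts are combined by concavity. -/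
lemma ConverseBound.le_log_card [Nonempty M] {W : A → B → ℝ} {ρ : A → C → ℝ} {r : ℝ}
    (h : ConverseBound W ρ r) (hW : ∀ x, IsLaw (W x)) {P : A → ℝ} (hP : IsLaw P) (e : A → M)
    (d : M → B → C) :
    r ≤ log (Fintype.card M) + ∑ y, negMulLog (expect P fun x => W x y) - ∑ x, negMulLog (P x) +
      expect P fun x => expect (W x) fun y => ρ x (d (e x) y) := by
  classical
  let μ : M → A → ℝ := fun m x => if e x = m then P x else 0
  have hμ : ∀ m x, 0 ≤ μ m x := fun m x => ite_nonneg (hP.nonneg x) le_rfl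
  have hmass : ∀ x, ∑ m, μ m x = P x := fun x => by simp [μ]
  have hin : ∀ x, ∑ m, negMulLog (μ m x) = negMulLog (P x) := fun x => by
    simp [μ, apply_ite negMulLog]
  have hout := sum_negMulLog_output_le hW hP hμ hmass
  have hdist : ∑ m, ∑ x, ∑ y, μ m x * W x y * ρ x (d m y) =
      expect P fun x => expect (W x) fun y => ρ x (d (e x) y) := by
    rw [Finset.sum_comm]
    refine Finset.sum_congr rfl fun x _ => ?_
    simp only [mul_assoc, ← Finset.mul_sum]
    simp only [μ, ite_mul, zero_mul, Finset.sum_ite_eq, Finset.mem_univ, if_true, expect]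
  have hbound := Finset.sum_le_sum fun (m : M) (_ : m ∈ Finset.univ) => h (μ m) (hμ m) (d m)
  rw [← Finset.mul_sum, Finset.sum_add_distrib, Finset.sum_sub_distrib, hdist,
    Finset.sum_comm (f := fun m x => μ m x), Finset.sum_comm (f := fun m x => negMulLog (μ m x))]
    at hbound
  simp only [hmass, hin, hP.sum_eq_one, mul_one] at hbound
  linarith

variable {p a b : ℝ} {n : ℕ}

lemma exists_eq_mul_bern {μ : ZMod 2 → ℝ} (hμ : ∀ x, 0 ≤ μ x) :
    ∃ s θ : ℝ, 0 ≤ s ∧ θ ∈ Set.Icc 0 1 ∧ μ = fun x => s * bern θ x := by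
  rcases (add_nonneg (hμ 0) (hμ 1)).eq_or_lt' with hzero | hpos
  · have hμ0 : ∀ x, μ x = 0 := fun x => by
      rcases zmod_two_eq_zero_or_one x with rfl | rfl <;> linarith [hμ 0, hμ 1]
    exact ⟨0, 0, le_rfl, by simp, funext fun x => by rw [hμ0, zero_mul]⟩
  · refine ⟨μ 0 + μ 1, μ 1 / (μ 0 + μ 1), hpos.le, ⟨div_nonneg (hμ 1) hpos.le,
      (div_le_one hpos).2 (by linarith [hμ 0])⟩, funext fun x => ?_⟩
    rcases zmod_two_eq_zero_or_one x with rfl | rfl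
    · rw [bern_zero]; field_simp; ring
    · rw [bern_one]; field_simp

lemma sum_negMulLog_output_sub_input (p s θ : ℝ) :
    ∑ y, negMulLog (∑ x, s * bern θ x * bern p (x - y)) - ∑ x, negMulLog (s * bern θ x) =
      s * gainNats p θ := by
  have hsub : (0 : ZMod 2) - 1 = 1 := by decide
  have hzero : s * (1 - θ) * (1 - p) + s * θ * p = s * (1 - star p θ) := by unfold star; ring
  have hone : s * (1 - θ) * p + s * θ * (1 - p) = s * star p θ := by unfold star; ring
  simp only [sum_zmod_two, sub_zero, sub_self, hsub, bern_zero, bern_one, hzero, hone,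
    negMulLog_mul, gainNats, binEntropy_eq_negMulLog_add_negMulLog_one_sub]
  ring

/-- The four decoders of one symbol have distortions `θ`, `p`, `1 - p` and `1 - θ`. -/
lemma le_gainNats_add_distortion (hp : p ∈ Set.Ioo 0 1) (hp' : p ≤ 1 / 2) (hb : 0 ≤ b)
    (hline : ∀ d ∈ Set.Icc (0 : ℝ) 1, a - b * d ≤ gainNats p d) (hab : a ≤ b * p) {θ : ℝ}
    (hθ : θ ∈ Set.Icc 0 1) (f : ZMod 2 → ZMod 2) :
    a ≤ gainNats p θ + ∑ x, ∑ y, bern θ x * bern p (x - y) * (b * ind (x ≠ f y)) := by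
  have hnonneg := gainNats_nonneg hp hθ
  have hle := hline θ hθ
  have hle' := hline (1 - θ) ⟨by linarith [hθ.2], by linarith [hθ.1]⟩
  rw [gainNats_one_sub] at hle'
  have hbp : b * p ≤ b * (1 - p) := mul_le_mul_of_nonneg_left (by linarith) hb
  have hsub : (0 : ZMod 2) - 1 = 1 := by decide
  simp only [sum_zmod_two, sub_zero, sub_self, hsub, bern_zero, bern_one, ind]
  rcases zmod_two_eq_zero_or_one (f 0) with h₀ | h₀ <;>
    rcases zmod_two_eq_zero_or_one (f 1) with h₁ | h₁ <;>
    simp only [h₀, h₁, ne_eq, not_true_eq_false, if_false, zero_ne_one, one_ne_zero,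
      not_false_eq_true, if_true, mul_zero, mul_one, zero_add, add_zero] <;>
    linarith

lemma converseBound_letter (hp : p ∈ Set.Ioo 0 1) (hp' : p ≤ 1 / 2) (hb : 0 ≤ b)
    (hline : ∀ d ∈ Set.Icc (0 : ℝ) 1, a - b * d ≤ gainNats p d) (hab : a ≤ b * p) :
    ConverseBound (fun x y : ZMod 2 => bern p (x - y)) (fun x z => b * ind (x ≠ z)) a := by
  intro μ hμ f
  obtain ⟨s, θ, hs, hθ, rfl⟩ := exists_eq_mul_bern hμ
  have hletter := mul_le_mul_of_nonneg_left
    (le_gainNats_add_distortion hp hp' hb hline hab hθ f) hs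
  simp only [sum_negMulLog_output_sub_input]
  simp only [← Finset.mul_sum, mul_assoc, (isLaw_bern hθ).sum_eq_one, mul_one] at hletter ⊢
  linarith

lemma isLaw_word_channel (hp : p ∈ Set.Icc 0 1) (x : Word n) :
    IsLaw fun y => iidProb (bern p) (x - y) where
  nonneg y := (isLaw_bern hp).pi.nonneg (x - y)
  sum_eq_one := ((Equiv.subLeft x).sum_comp _).trans (isLaw_bern hp).pi.sum_eq_one

lemma sum_word_succ {R : Type*} [AddCommMonoid R] (F : Word (n + 1) → R) :
    ∑ x, F x = ∑ s : ZMod 2 × Word n, F (Fin.cons s.1 s.2) :=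
  ((Fin.consEquiv fun _ => ZMod 2).sum_comp F).symm

lemma iidProb_cons_sub_cons (P : ZMod 2 → ℝ) (s t : ZMod 2) (x y : Word n) :
    iidProb P (Fin.cons s x - Fin.cons t y : Word (n + 1)) = P (s - t) * iidProb P (x - y) := by
  simp only [iidProb, Fin.prod_univ_succ, Pi.sub_apply, Fin.cons_zero, Fin.cons_succ]

lemma hammingDist_cons (s : ZMod 2) (x : Word n) (z : Word (n + 1)) :
    (hammingDist (Fin.cons s x : Word (n + 1)) z : ℝ) =
      ind (s ≠ z 0) + hammingDist x (Fin.tail z) := by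
  simp only [hammingDist_eq_sum_ind, Fin.sum_univ_succ, Fin.cons_zero, Fin.cons_succ, Fin.tail]

lemma converseBound_word (hp : p ∈ Set.Icc 0 1)
    (h : ConverseBound (fun x y : ZMod 2 => bern p (x - y)) (fun x z => b * ind (x ≠ z)) a)
    (n : ℕ) : ConverseBound (fun x y : Word n => iidProb (bern p) (x - y))
      (fun x z : Word n => b * hammingDist x z) (n * a) := by
  induction n with
  | zero => intro μ _ f; simp [iidProb, hammingDist]
  | succ n ih =>
    intro μ hμ f
    have hletter : ∀ s, IsLaw fun t => bern p (s - t) := fun s =>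
      ⟨fun t => (isLaw_bern hp).nonneg _,
        ((Equiv.subLeft s).sum_comp _).trans (isLaw_bern hp).sum_eq_one⟩
    have hprod := h.prod ih hletter (isLaw_word_channel hp) (fun s => μ (Fin.cons s.1 s.2))
      (fun s => hμ _) fun t => (f (Fin.cons t.1 t.2) 0, Fin.tail (f (Fin.cons t.1 t.2)))
    simp only [sum_word_succ, iidProb_cons_sub_cons, hammingDist_cons, mul_add b]
    push_cast
    linarith

lemma WZCode.distortion_eq_expect_sideInfo {N : Type} (C : WZCode n N) (p : ℝ) :
    C.distortion p = expect (uniform n) fun y => expect (piLaw (bern p)) fun z =>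
      (hammingDist (y + z) (C.dec (C.enc (y + z)) y) : ℝ) / n := by
  simp only [WZCode.distortion, expect, Finset.mul_sum, mul_assoc]
  rfl

lemma WZCode.distortion_eq_expect_source {N : Type} (C : WZCode n N) (p : ℝ) :
    C.distortion p = expect (uniform n) fun x => expect (piLaw (bern p)) fun z =>
      (hammingDist x (C.dec (C.enc x) (x - z)) : ℝ) / n := by
  rw [C.distortion_eq_expect_sideInfo, expect_comm, expect_comm (uniform n)]
  congr 1 with z
  rw [← expect_uniform_comp _ (Equiv.subRight z)]
  simp only [Equiv.subRight_apply, sub_add_cancel]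

lemma expect_word_channel (p : ℝ) (x : Word n) (g : Word n → ℝ) :
    (expect (fun y => iidProb (bern p) (x - y)) g) =
      expect (piLaw (bern p)) fun z => g (x - z) := by
  rw [expect, ← (Equiv.subLeft x).sum_comp]
  simp only [Equiv.subLeft_apply, sub_sub_cancel]
  rfl

lemma expect_uniform_word_channel (hp : p ∈ Set.Icc 0 1) (y : Word n) :
    (expect (uniform n) fun x => iidProb (bern p) (x - y)) = uniform n y := by
  simp only [expect, uniform_apply, ← Finset.mul_sum]
  have hsum : ∑ x, iidProb (bern p) (x - y) = 1 :=
    ((Equiv.subRight y).sum_comp (iidProb (bern p))).trans (isLaw_bern hp).pi.sum_eq_one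
  rw [hsum, mul_one]

lemma WZCode.sub_mul_distortion_le (hp : p ∈ Set.Ioo 0 1) (hp' : p ≤ 1 / 2) (hb : 0 ≤ b)
    (hline : ∀ d ∈ Set.Icc (0 : ℝ) 1, a - b * d ≤ gainNats p d) (hab : a ≤ b * p) (hn : 0 < n)
    {N : ℕ} (C : WZCode n (Fin N)) : n * (a - b * C.distortion p) ≤ log N := by
  have hpI := Set.Ioo_subset_Icc_self hp
  have hn' : (n : ℝ) ≠ 0 := (Nat.cast_pos.2 hn).ne'
  have : Nonempty (Fin N) := ⟨C.enc 0⟩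
  have hword := (converseBound_word hpI (converseBound_letter hp hp' hb hline hab) n).le_log_card
    (isLaw_word_channel hpI) (isLaw_uniform n) C.enc C.dec
  have hdist : n * C.distortion p = expect (uniform n) fun x => expect (piLaw (bern p)) fun z =>
      (hammingDist x (C.dec (C.enc x) (x - z)) : ℝ) := by
    simp only [C.distortion_eq_expect_source, ← expect_const_mul, mul_div_cancel₀ _ hn']
  simp only [expect_uniform_word_channel hpI, expect_word_channel, expect_const_mul, ← hdist,
    Fintype.card_fin] at hword
  linarith

variable {R D D' d t : ℝ}

lemma WZAchievable.line_le (h : WZAchievable p R D) (hp : p ∈ Set.Ioo 0 1) (hp' : p ≤ 1 / 2)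
    (hb : 0 ≤ b) (hline : ∀ d ∈ Set.Icc (0 : ℝ) 1, a - b * d ≤ gainNats p d) (hab : a ≤ b * p) :
    a - b * D ≤ R * log 2 := by
  have hbound : ∀ η : ℝ, 0 < η → a - b * (D + η) ≤ (R + η) * log 2 := fun η hη => by
    obtain ⟨n, ⟨N, C, hN, hC⟩, hn⟩ := ((h η hη).and (eventually_gt_atTop 0)).exists
    have hn' : (0 : ℝ) < n := Nat.cast_pos.2 hn
    have hlog := log_le_log (Nat.cast_pos.2 (Fin.pos (C.enc 0))) hN
    rw [log_rpow two_pos, mul_assoc] at hlog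
    refine le_of_mul_le_mul_left ?_ hn'
    calc n * (a - b * (D + η)) ≤ n * (a - b * C.distortion p) := by gcongr
      _ ≤ n * ((R + η) * log 2) := (C.sub_mul_distortion_le hp hp' hb hline hab hn).trans hlog
  have hlimit : ∀ r s : ℝ, Tendsto (fun η => r + s * η) (𝓝[>] 0) (𝓝 r) := fun r s =>
    (Continuous.tendsto' (by fun_prop) _ _ (by simp)).mono_left nhdsWithin_le_nhds
  refine le_of_tendsto_of_tendsto (hlimit _ (-b)) (hlimit _ (log 2)) ?_
  filter_upwards [self_mem_nhdsWithin] with η hη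
  linarith [hbound η hη]

lemma gainSlope_nonpos (hp : p ∈ Set.Ioo 0 1) (hd : d ∈ Set.Ioo 0 p)
    (hgap : 0 ≤ tangentGap p d) : gainSlope p d ≤ 0 := by
  have hgain := gainNats_nonneg hp (d := d) ⟨hd.1.le, (hd.2.trans hp.2).le⟩
  unfold tangentGap at hgap
  exact nonpos_of_mul_nonneg_left (by linarith) (sub_neg.2 hd.2)

lemma WZAchievable.tangent_le (h : WZAchievable p R D) (hp : p ∈ Set.Ioo 0 1) (hp' : p ≤ 1 / 2)
    (hD' : IsThreshold p D') (hd : d ∈ Set.Ioc 0 D') :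
    gainNats p d + gainSlope p d * (D - d) ≤ R * log 2 := by
  have hgap := hD'.tangentGap_nonneg hp.2 hd
  have hdp : d ∈ Set.Ioo 0 p := ⟨hd.1, hd.2.trans_lt hD'.2.1⟩
  have hline := h.line_le (a := gainNats p d - gainSlope p d * d) (b := -gainSlope p d) hp hp'
    (neg_nonneg.2 (gainSlope_nonpos hp hdp hgap))
    (fun e he => by linarith [gainNats_tangent_le hp ⟨hdp.1, hdp.2.trans hp.2⟩ he])
    (by unfold tangentGap at hgap; linarith)
  linarith

/-- The tangent at `D` gives the bound; at `D = 0`, where the curve has a vertical tangent, it is a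
limit of the bounds given by the tangents at `d > 0`. -/
lemma WZAchievable.R1star_le (h : WZAchievable p R D) (hp : p ∈ Set.Ioo 0 1) (hp' : p ≤ 1 / 2)
    (hD' : IsThreshold p D') (hD : D ∈ Set.Icc 0 D') : R1star p D ≤ R := by
  rw [R1star_eq_gainNats_div, div_le_iff₀ log_two_pos]
  rcases hD.1.eq_or_lt' with rfl | hpos
  · have hbound : ∀ᶠ d in 𝓝[>] (0 : ℝ), gainNats p d ≤ R * log 2 := by
      filter_upwards [Ioc_mem_nhdsGT hD'.1] with d hd
      have hslope := gainSlope_nonpos hp ⟨hd.1, hd.2.trans_lt hD'.2.1⟩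
        (hD'.tangentGap_nonneg hp.2 hd)
      nlinarith [h.tangent_le hp hp' hD' hd, hd.1]
    exact le_of_tendsto (((continuous_gainNats p).tendsto 0).mono_left nhdsWithin_le_nhds) hbound
  · simpa only [sub_self, mul_zero, add_zero] using h.tangent_le hp hp' hD' ⟨hpos, hD.2⟩

lemma WZAchievable.mul_R1star_le (h : WZAchievable p R (t * D' + (1 - t) * p))
    (hp : p ∈ Set.Ioo 0 1) (hp' : p ≤ 1 / 2) (hD' : IsThreshold p D') : t * R1star p D' ≤ R := by
  have htangent := h.tangent_le hp hp' hD' ⟨hD'.1, le_rfl⟩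
  have hgap := ((isThreshold_iff hp.2).1 hD').2
  unfold tangentGap at hgap
  rw [R1star_eq_gainNats_div, ← mul_div_assoc, div_le_iff₀ log_two_pos]
  linear_combination htangent + (1 - t) * hgap

end Converse

/-! ### Pairs of random codebooks -/

section Codebooks

variable {A B : Type*} [Fintype A] [Fintype B] {α : A → ℝ} {β : B → ℝ} {M₀ M₁ : ℕ}

/-- The law of two independent codebooks with `M₀` and `M₁` independent codewords, of law `α` in
the first and of law `β` in the second. -/
noncomputable def codebookLaw (α : A → ℝ) (β : B → ℝ) (M₀ M₁ : ℕ) :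
    (Fin M₀ → A) × (Fin M₁ → B) → ℝ := prodLaw (piLaw α) (piLaw β)

lemma IsLaw.codebook (hα : IsLaw α) (hβ : IsLaw β) (M₀ M₁ : ℕ) :
    IsLaw (codebookLaw α β M₀ M₁) := hα.pi.prod hβ.pi

lemma expect_codebookLaw (f : (Fin M₀ → A) × (Fin M₁ → B) → ℝ) :
    expect (codebookLaw α β M₀ M₁) f =
      expect (piLaw α) fun c₀ => expect (piLaw β) fun c₁ => f (c₀, c₁) := expect_prodLaw _ _ f

lemma expect_codebookLaw_apply (hα : IsLaw α) (hβ : IsLaw β) (i : Fin M₀) (j : Fin M₁)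
    (g : A → B → ℝ) :
    (expect (codebookLaw α β M₀ M₁) fun c => g (c.1 i) (c.2 j)) =
      expect α fun a => expect β (g a) := by
  simp only [expect_codebookLaw, hβ.expect_piLaw_apply]
  exact hα.expect_piLaw_apply i fun a => expect β (g a)

/-- The number of pairs of codewords with the property `G`, one from each codebook. -/
noncomputable def pairsCount (G : A → B → Prop) (c : (Fin M₀ → A) × (Fin M₁ → B)) : ℝ :=
  ∑ i, ∑ j, ind (G (c.1 i) (c.2 j))

lemma pairsCount_mono {A B : Type*} {G G' : A → B → Prop} (h : ∀ a b, G a b → G' a b)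
    (c : (Fin M₀ → A) × (Fin M₁ → B)) : pairsCount G c ≤ pairsCount G' c :=
  Finset.sum_le_sum fun _ _ => Finset.sum_le_sum fun _ _ => ind_mono (h _ _)

variable {G : A → B → Prop} {K L ρ : ℝ}

lemma expect_pairsCount (hα : IsLaw α) (hβ : IsLaw β) :
    (expect (codebookLaw α β M₀ M₁) fun c => pairsCount G c) =
      M₀ * M₁ * expect α fun a => prob β (G a) := by
  simp only [pairsCount, expect_sum, expect_codebookLaw_apply hα hβ _ _ fun a b => ind (G a b),
    Finset.sum_const, Finset.card_univ, Fintype.card_fin, nsmul_eq_mul, mul_assoc, prob]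

lemma expect_codebookLaw_mul_le (hα : IsLaw α) (hβ : IsLaw β)
    (hρ : (expect α fun a => prob β (G a)) = ρ) (hrow : ∀ a, prob β (G a) ≤ K)
    (hcol : ∀ b, (prob α fun a => G a b) ≤ L) (i k : Fin M₀) (j l : Fin M₁) :
    (expect (codebookLaw α β M₀ M₁) fun c =>
      ind (G (c.1 i) (c.2 j)) * ind (G (c.1 k) (c.2 l))) ≤
      if i = k then (if j = l then ρ else K * ρ) else (if j = l then L * ρ else ρ ^ 2) := by
  have hρ' : (expect β fun b => prob α fun a => G a b) = ρ := (expect_comm _ _ _).trans hρ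
  split_ifs with hik hjl hjl
  · subst hik hjl
    simp only [← ind_and, and_self]
    exact ((expect_codebookLaw_apply hα hβ i j fun a b => ind (G a b)).trans hρ).le
  · subst hik
    have hcolumns : ∀ c₀ : Fin M₀ → A, (expect (piLaw β) fun c₁ => ind (G (c₀ i) (c₁ j)) *
        ind (G (c₀ i) (c₁ l))) = prob β (G (c₀ i)) * prob β (G (c₀ i)) := fun c₀ =>
      hβ.expect_piLaw_mul_apply hjl (fun b => ind (G (c₀ i) b)) fun b => ind (G (c₀ i) b)
    simp only [expect_codebookLaw, hcolumns]
    rw [hα.expect_piLaw_apply i fun a => prob β (G a) * prob β (G a), ← hρ, ← expect_const_mul]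
    exact hα.expect_mono fun a => mul_le_mul_of_nonneg_right (hrow a) (hβ.prob_nonneg _)
  all_goals
    have hrows : ∀ c₁ : Fin M₁ → B, (expect (piLaw α) fun c₀ => ind (G (c₀ i) (c₁ j)) *
        ind (G (c₀ k) (c₁ l))) = (prob α fun a => G a (c₁ j)) * prob α fun a => G a (c₁ l) :=
      fun c₁ => hα.expect_piLaw_mul_apply hik (fun a => ind (G a (c₁ j)))
        fun a => ind (G a (c₁ l))
    rw [expect_codebookLaw, expect_comm]
    simp only [hrows]
  · subst hjl
    rw [hβ.expect_piLaw_apply j fun b => (prob α fun a => G a b) * prob α fun a => G a b,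
      ← hρ', ← expect_const_mul]
    exact hβ.expect_mono fun b => mul_le_mul_of_nonneg_right (hcol b) (hα.prob_nonneg _)
  · rw [hβ.expect_piLaw_mul_apply hjl (fun b => prob α fun a => G a b)
      fun b => prob α fun a => G a b, hρ', sq]

lemma expect_pairsCount_sq_le (hα : IsLaw α) (hβ : IsLaw β)
    (hρ : (expect α fun a => prob β (G a)) = ρ) (hrow : ∀ a, prob β (G a) ≤ K)
    (hcol : ∀ b, (prob α fun a => G a b) ≤ L) :
    (expect (codebookLaw α β M₀ M₁) fun c => pairsCount G c ^ 2) ≤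
      (M₀ * M₁ * ρ) ^ 2 + M₀ * M₁ * ρ * (1 + M₁ * K + M₀ * L) := by
  have hρ0 : 0 ≤ ρ := hρ ▸ hα.expect_nonneg fun a => hβ.prob_nonneg _
  have hK : 0 ≤ K := (hβ.prob_nonneg _).trans (hrow hα.nonempty.some)
  have hL : 0 ≤ L := (hα.prob_nonneg _).trans (hcol hβ.nonempty.some)
  have hpair : ∀ (i k : Fin M₀) (j l : Fin M₁), (expect (codebookLaw α β M₀ M₁) fun c =>
      ind (G (c.1 i) (c.2 j)) * ind (G (c.1 k) (c.2 l))) ≤ ρ ^ 2 +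
        (if i = k then K * ρ else 0) + (if j = l then L * ρ else 0) +
        (if i = k then (if j = l then ρ else 0) else 0) := fun i k j l => by
    refine (expect_codebookLaw_mul_le hα hβ hρ hrow hcol i k j l).trans ?_
    split_ifs <;> nlinarith [mul_nonneg hK hρ0, mul_nonneg hL hρ0, sq_nonneg ρ]
  calc (expect (codebookLaw α β M₀ M₁) fun c => pairsCount G c ^ 2)
      = ∑ i, ∑ k, ∑ j, ∑ l, expect (codebookLaw α β M₀ M₁) fun c =>
          ind (G (c.1 i) (c.2 j)) * ind (G (c.1 k) (c.2 l)) := by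
        simp only [pairsCount, sq, Finset.sum_mul_sum, expect_sum]
    _ ≤ _ := Finset.sum_le_sum fun i _ => Finset.sum_le_sum fun k _ =>
        Finset.sum_le_sum fun j _ => Finset.sum_le_sum fun l _ => hpair i k j l
    _ = (M₀ * M₁ * ρ) ^ 2 + M₀ * M₁ * ρ * (1 + M₁ * K + M₀ * L) := by
        simp only [Finset.sum_add_distrib, Finset.sum_const, Finset.sum_ite_irrel,
          Finset.sum_ite_eq, Finset.mem_univ, if_true, Finset.card_univ, Fintype.card_fin,
          nsmul_eq_mul, mul_ite, mul_zero]
        ring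

lemma prob_pairsCount_lt_le (hα : IsLaw α) (hβ : IsLaw β) (hM₀ : 0 < M₀) (hM₁ : 0 < M₁)
    (hρ : (expect α fun a => prob β (G a)) = ρ) (hρ0 : 0 < ρ) (hrow : ∀ a, prob β (G a) ≤ K)
    (hcol : ∀ b, (prob α fun a => G a b) ≤ L) :
    (prob (codebookLaw α β M₀ M₁) fun c => pairsCount G c < M₀ * M₁ * ρ / 2) ≤
      4 * (1 / (M₀ * M₁ * ρ) + K / (M₀ * ρ) + L / (M₁ * ρ)) := by
  have hlaw := hα.codebook hβ M₀ M₁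
  set μ := M₀ * M₁ * ρ with hμ
  have hμ0 : 0 < μ := by positivity
  have hvar : (expect (codebookLaw α β M₀ M₁) fun c => (pairsCount G c - μ) ^ 2) ≤
      μ * (1 + M₁ * K + M₀ * L) := by
    rw [hlaw.expect_sq_sub, expect_pairsCount hα hβ, hρ, ← hμ]
    linarith [expect_pairsCount_sq_le (M₀ := M₀) (M₁ := M₁) hα hβ hρ hrow hcol]
  calc (prob (codebookLaw α β M₀ M₁) fun c => pairsCount G c < μ / 2)
      ≤ prob (codebookLaw α β M₀ M₁) fun c => (μ / 2) ^ 2 ≤ (pairsCount G c - μ) ^ 2 :=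
        hlaw.prob_mono fun c hc => by nlinarith
    _ ≤ μ * (1 + M₁ * K + M₀ * L) / (μ / 2) ^ 2 :=
        (hlaw.prob_le_expect_div (fun c => sq_nonneg _) (by positivity)).trans (by gcongr)
    _ = 4 * (1 / μ + K / (M₀ * ρ) + L / (M₁ * ρ)) := by rw [hμ]; field_simp; ring

end Codebooks

/-! ### The random choice of the encoder -/

section Choices

open Classical in
/-- Probability that an element drawn uniformly from `orAll F` has the property `S`. -/
noncomputable def choiceProb {σ : Type} [Fintype σ] (F S : σ → Prop) : ℝ :=
  (((orAll F).filter S).card : ℝ) / (orAll F).card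

variable {σ : Type} [Fintype σ]

lemma choiceProb_nonneg (F S : σ → Prop) : 0 ≤ choiceProb F S := by
  unfold choiceProb; positivity

open Classical in
lemma choiceProb_le_one (F S : σ → Prop) : choiceProb F S ≤ 1 := by
  unfold choiceProb
  exact div_le_one_of_le₀ (Nat.cast_le.2 (Finset.card_filter_le _ _)) (Nat.cast_nonneg _)

lemma choiceProb_le (F S : σ → Prop) {τ : ℝ} (hτ : 0 < τ) :
    choiceProb F S ≤ ind (∑ s, ind (F s) < τ) + (∑ s, ind (F s ∧ S s)) / τ := by
  classical
  have hfailures : 0 ≤ (∑ s, ind (F s ∧ S s)) / τ :=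
    div_nonneg (Finset.sum_nonneg fun s _ => ind_nonneg _) hτ.le
  by_cases hfew : ∑ s, ind (F s) < τ
  · rw [ind_of hfew]
    exact (choiceProb_le_one F S).trans (le_add_of_nonneg_right hfailures)
  have hexists : ∃ s, F s := by
    by_contra! hnone
    exact hfew (by simpa only [ind_of_not (hnone _), Finset.sum_const_zero] using hτ)
  have hcard : ∀ (P : σ → Prop) [DecidablePred P],
      ((Finset.univ.filter P).card : ℝ) = ∑ s, ind (P s) := fun P _ => by
    rw [Finset.card_filter]
    push_cast
    exact Finset.sum_congr rfl fun s _ => by unfold ind; congr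
  rw [ind_of_not hfew, zero_add, choiceProb, orAll, if_pos hexists, Finset.filter_filter]
  simp only [hcard]
  exact div_le_div_of_nonneg_left (Finset.sum_nonneg fun s _ => ind_nonneg _) hτ
    (not_lt.1 hfew)

lemma IsLaw.expect_choiceProb_le {A B : Type*} [Fintype A] [Fintype B] {v : A → ℝ} {w : B → ℝ}
    (hv : IsLaw v) (hw : IsLaw w) (F : A → σ → Prop) (S : A → B → σ → Prop) {τ : ℝ}
    (hτ : 0 < τ) :
    (expect v fun a => expect w fun b => choiceProb (F a) (S a b)) ≤
      (prob v fun a => ∑ s, ind (F a s) < τ) +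
        (∑ s, expect v fun a => prob w fun b => F a s ∧ S a b s) / τ := by
  refine (hv.expect_mono fun a => hw.expect_mono fun b => choiceProb_le _ _ hτ).trans_eq ?_
  simp only [expect_add, hw.expect_const, div_eq_mul_inv, expect_mul_const, expect_sum, prob]

end Choices

section Scheme

variable {n M₀ M₁ : ℕ} {p q D ε : ℝ}

lemma expect_uniform_expect_sub (v : Word n → ℝ) (f : Word n → Word n → ℝ) :
    (expect (uniform n) fun a => expect v fun b => f a b) =
      expect (uniform n) fun u => expect v fun b => f (u - b) b := by
  rw [expect_comm, expect_comm (uniform n)]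
  congr 1 with b
  exact (expect_uniform_comp (fun a => f a b) (Equiv.subRight b)).symm

/-- The source word `x = y + z` is uniform and independent of the noise `z`, so the encoder can
be analysed for a fixed `x`. -/
lemma schemeProb_eq
    (E : (Fin M₀ → Word n) → (Fin M₁ → Word n) → Word n → Word n → Fin M₀ × Fin M₁ → Prop) :
    schemeProb p q D ε n M₀ M₁ E = expect (uniform n) fun x =>
      expect (codebookLaw (uniform n) (piLaw (bern q)) M₀ M₁) fun c =>
        expect (piLaw (bern p)) fun z =>
          choiceProb (fun s => JointlyTypical ε (additiveLaw (bern D)) (c.1 s.1 + c.2 s.2) x)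
            (E c.1 c.2 (x - z) z) := by
  let Φ : (Fin M₀ → Word n) × (Fin M₁ → Word n) → Word n → Word n → ℝ := fun c y z =>
    choiceProb (fun s => JointlyTypical ε (additiveLaw (bern D)) (c.1 s.1 + c.2 s.2) (y + z))
      (E c.1 c.2 y z)
  calc schemeProb p q D ε n M₀ M₁ E
      = expect (codebookLaw (uniform n) (piLaw (bern q)) M₀ M₁) fun c =>
          expect (uniform n) fun y => expect (piLaw (bern p)) fun z => Φ c y z := by
        rw [expect_codebookLaw]
        simp only [expect, Finset.mul_sum, ← mul_assoc]
        rfl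
    _ = expect (codebookLaw (uniform n) (piLaw (bern q)) M₀ M₁) fun c =>
          expect (uniform n) fun x => expect (piLaw (bern p)) fun z => Φ c (x - z) z :=
        congrArg (expect _) (funext fun c => expect_uniform_expect_sub (piLaw (bern p)) (Φ c))
    _ = _ := by
        rw [expect_comm]
        simp only [Φ, sub_add_cancel]

end Scheme

section Covering

variable {n M₀ M₁ : ℕ} {q r D δ ε ε₁ : ℝ} {x : Word n}

lemma LikelihoodTolerance.mono {ε₀ : ℝ} (h : LikelihoodTolerance r δ ε₀) (hε : ε₁ ≤ ε₀) :
    LikelihoodTolerance r δ ε₁ :=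
  fun n w hw hdev => h n w hw (hdev.trans (by gcongr))

lemma half_pow_eq_rpow (n : ℕ) : (1 / 2 : ℝ) ^ n = (2 : ℝ) ^ (-(n : ℝ)) := by
  rw [Real.rpow_neg two_pos.le, Real.rpow_natCast, one_div, inv_pow]

lemma word_sub_sub (x u b : Word n) : x - (u - b) = x - u - b := by
  funext k
  simp only [Pi.sub_apply, CharTwo.sub_eq_add, add_assoc]

/-- Probability that a uniform word is `ε`-jointly typical with `w`, for the noise `B(r)`. -/
noncomputable def typicalProb (r ε : ℝ) (w : Word n) : ℝ :=
  prob (uniform n) fun u => JointlyTypical ε (additiveLaw (bern r)) u w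

lemma typicalProb_eq_sum (w : Word n) :
    typicalProb r ε w =
      ∑ s, (1 / 2) ^ n * ind (JointlyTypical ε (additiveLaw (bern r)) (w - s) w) := by
  rw [typicalProb, ← prob_uniform_comp _ (Equiv.subLeft w), prob, expect]
  simp only [uniform_apply, Equiv.subLeft_apply]

lemma prob_jointlyTypical_mul_le_typicalProb (hr : LikelihoodTolerance r δ ε₁) (hn : 0 < n)
    (hε : ε / 2 ≤ ε₁) (w : Word n) :
    (prob (piLaw (bern r)) fun s => JointlyTypical ε (additiveLaw (bern r)) (w - s) w) *
      (2 : ℝ) ^ (-(n * (1 - h2 r + δ))) ≤ typicalProb r ε w := by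
  rw [typicalProb_eq_sum, prob, expect, Finset.sum_mul]
  refine Finset.sum_le_sum fun s _ => ?_
  by_cases h : JointlyTypical ε (additiveLaw (bern r)) (w - s) w
  · have hlik := (h.piLaw_bern_sub_bounds hr hn hε).2
    rw [sub_sub_cancel] at hlik
    rw [ind_of h, mul_one, mul_one]
    refine (mul_le_mul_of_nonneg_right hlik (by positivity)).trans_eq ?_
    rw [half_pow_eq_rpow, ← Real.rpow_add two_pos]
    ring_nf
  · rw [ind_of_not h, mul_zero, mul_zero, zero_mul]

lemma typicalProb_le (hr' : r ∈ Set.Icc 0 1) (hr : LikelihoodTolerance r δ ε₁) (hn : 0 < n)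
    (hε : ε / 2 ≤ ε₁) (w : Word n) :
    typicalProb r ε w ≤ (2 : ℝ) ^ (-(n * (1 - h2 r - δ))) := by
  have hlaw := (isLaw_bern hr').pi (ι := Fin n)
  have htotal := hlaw.expect_const ((2 : ℝ) ^ (-(n * (1 - h2 r - δ))))
  rw [expect] at htotal
  rw [typicalProb_eq_sum, ← htotal]
  refine Finset.sum_le_sum fun s _ => ?_
  by_cases h : JointlyTypical ε (additiveLaw (bern r)) (w - s) w
  · have hlik := (h.piLaw_bern_sub_bounds hr hn hε).1
    rw [sub_sub_cancel] at hlik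
    rw [ind_of h, mul_one]
    refine le_trans (le_of_eq ?_) (mul_le_mul_of_nonneg_right hlik (by positivity))
    rw [half_pow_eq_rpow, ← Real.rpow_add two_pos]
    ring_nf
  · rw [ind_of_not h, mul_zero]
    exact mul_nonneg (hlaw.nonneg s) (by positivity)

lemma Balanced.le_typicalProb (hx : Balanced (ε / 8) x) (hD : D ∈ Set.Icc 0 1)
    (hlik : LikelihoodTolerance D δ ε₁) (hn : 0 < n) (hε : 0 < ε) (hε₁ : ε / 2 ≤ ε₁)
    (hlarge : 4 / (n * (ε / 8) ^ 2) ≤ 1 / 2) :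
    1 / 2 * (2 : ℝ) ^ (-(n * (1 - h2 D + δ))) ≤ typicalProb D ε x := by
  refine le_trans ?_ (prob_jointlyTypical_mul_le_typicalProb hlik hn hε₁ x)
  have hmiss := (hx.prob_not_jointlyTypical_le hn hD hε).trans hlarge
  rw [(isLaw_bern hD).pi.prob_not] at hmiss
  gcongr
  linarith

/-- The pair of codewords `(a, b)` covers `x`, and the noise `x - a` left by the first codeword
looks like noise of law `B(q ∗ D)`. The second clause, which nearly all covering pairs satisfy,
bounds the number of `b` covering `x` together with a given `a`. -/
def TypicalCover (q D ε ε₁ : ℝ) (x a b : Word n) : Prop :=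
  JointlyTypical ε (additiveLaw (bern D)) (a + b) x ∧
    |hammingNorm (x - a) - n * star q D| ≤ n * ε₁

lemma half_mul_typicalProb_le (hq : q ∈ Set.Icc 0 1) (hn : 0 < n) (hε : 0 < ε) (hε₁ : ε ≤ ε₁)
    (hlarge : 4 / (n * (ε / 8) ^ 2) ≤ 1 / 2) (x : Word n) :
    1 / 2 * typicalProb D ε x ≤
      expect (uniform n) fun a => prob (piLaw (bern q)) fun b => TypicalCover q D ε ε₁ x a b := by
  simp only [prob]
  rw [expect_uniform_expect_sub, typicalProb, prob, ← expect_const_mul]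
  refine (isLaw_uniform n).expect_mono fun u => ?_
  simp only [TypicalCover, sub_add_cancel, word_sub_sub, ind_and, expect_const_mul]
  rw [mul_comm]
  by_cases hu : JointlyTypical ε (additiveLaw (bern D)) u x
  · have hnear := (hu.pairFreqNear_sub hn).prob_not_sub_right_le (isLaw_bern hq) hn
      (show ε / 4 < ε₁ / 2 by linarith)
    have hsmall : 4 / (n * (ε₁ / 2 - ε / 4) ^ 2) ≤ 1 / 2 := by
      refine le_trans ?_ hlarge
      gcongr
      linarith
    rw [(isLaw_bern hq).pi.prob_not, conv_bern] at hnear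
    refine mul_le_mul_of_nonneg_left ?_ (ind_nonneg _)
    refine le_trans (sub_le_comm.1 (hnear.trans hsmall) |>.trans' (by norm_num))
      ((isLaw_bern hq).pi.prob_mono fun b hb => ?_)
    exact hb.abs_hammingNorm_sub_le.trans_eq (by ring)
  · rw [ind_of_not hu, zero_mul, zero_mul]

lemma sum_piLaw_mul_piLaw_sub (P Q : ZMod 2 → ℝ) (m : Word n) :
    ∑ b : Word n, piLaw P b * piLaw Q (m - b) = piLaw (conv P Q) m :=
  expect_piLaw_prod P fun k a => Q (m k - a)

lemma prob_typicalCover_le (hq : q ∈ Set.Icc 0 1) (hqD : star q D ≠ 0)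
    (hlik : LikelihoodTolerance D δ ε₁) (hlik' : LikelihoodTolerance (star q D) δ ε₁)
    (hD : D ∈ Set.Icc 0 1) (hn : 0 < n) (hε₁ : ε / 2 ≤ ε₁) (x a : Word n) :
    (prob (piLaw (bern q)) fun b => TypicalCover q D ε ε₁ x a b) ≤
      (2 : ℝ) ^ (-(n * (h2 (star q D) - h2 D - 2 * δ))) := by
  have hq' := (isLaw_bern hq).pi (ι := Fin n)
  have hD' := (isLaw_bern hD).pi (ι := Fin n)
  by_cases ha : |hammingNorm (x - a) - n * star q D| ≤ n * ε₁
  · calc (prob (piLaw (bern q)) fun b => TypicalCover q D ε ε₁ x a b)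
        ≤ ∑ b : Word n, (2 : ℝ) ^ (n * (h2 D + δ)) *
            (piLaw (bern q) b * piLaw (bern D) (x - a - b)) := by
          refine Finset.sum_le_sum fun b _ => ?_
          rw [mul_left_comm]
          refine mul_le_mul_of_nonneg_left ?_ (hq'.nonneg b)
          by_cases hb : JointlyTypical ε (additiveLaw (bern D)) (a + b) x
          · have hbounds := (hb.piLaw_bern_sub_bounds hlik hn hε₁).1
            rw [← sub_sub, Real.rpow_neg two_pos.le, inv_le_iff_one_le_mul₀' (by positivity)]
              at hbounds
            exact (ind_le_one _).trans hbounds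
          · refine (ind_of_not fun h : TypicalCover q D ε ε₁ x a b => hb h.1).trans_le ?_
            exact mul_nonneg (by positivity) (hD'.nonneg _)
      _ = (2 : ℝ) ^ (n * (h2 D + δ)) * piLaw (bern (star q D)) (x - a) := by
          rw [← Finset.mul_sum, sum_piLaw_mul_piLaw_sub, conv_bern]
      _ ≤ (2 : ℝ) ^ (n * (h2 D + δ)) * (2 : ℝ) ^ (-(n * (h2 (star q D) - δ))) := by
          gcongr
          exact (hlik' n _ (fun h => absurd h hqD) ha).2
      _ = (2 : ℝ) ^ (-(n * (h2 (star q D) - h2 D - 2 * δ))) := by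
          rw [← Real.rpow_add two_pos]
          ring_nf
  · simp only [prob, TypicalCover, ha, and_false, ind_of_not not_false, expect, mul_zero,
      Finset.sum_const_zero]
    positivity

lemma prob_jointlyTypical_add_right (b : Word n) :
    (prob (uniform n) fun a => JointlyTypical ε (additiveLaw (bern D)) (a + b) x) =
      typicalProb D ε x :=
  prob_uniform_comp (fun u => JointlyTypical ε (additiveLaw (bern D)) u x) (Equiv.addRight b)

lemma prob_pairsCount_jointlyTypical_lt_le (hq : q ∈ Set.Icc 0 1) (hD : D ∈ Set.Icc 0 1)
    (hM₀ : 0 < M₀) (hM₁ : 0 < M₁) (hqD : star q D ≠ 0) (hlik : LikelihoodTolerance D δ ε₁)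
    (hlik' : LikelihoodTolerance (star q D) δ ε₁) (hn : 0 < n) (hε : 0 < ε) (hε₁ : ε ≤ ε₁)
    (hlarge : 4 / (n * (ε / 8) ^ 2) ≤ 1 / 2) (hpos : 0 < typicalProb D ε x) :
    (prob (codebookLaw (uniform n) (piLaw (bern q)) M₀ M₁) fun c =>
        pairsCount (fun a b => JointlyTypical ε (additiveLaw (bern D)) (a + b) x) c <
          M₀ * M₁ * typicalProb D ε x / 4) ≤
      8 * (1 / (M₀ * M₁ * typicalProb D ε x) +
        (2 : ℝ) ^ (-(n * (h2 (star q D) - h2 D - 2 * δ))) / (M₀ * typicalProb D ε x) +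
        1 / M₁) := by
  have hU := isLaw_uniform n
  have hq' := (isLaw_bern hq).pi (ι := Fin n)
  set π := typicalProb D ε x
  set ρ := expect (uniform n) fun a => prob (piLaw (bern q)) fun b => TypicalCover q D ε ε₁ x a b
    with hρ
  have hρπ : 1 / 2 * π ≤ ρ := half_mul_typicalProb_le hq hn hε hε₁ hlarge x
  have hcolumn : ∀ b, (prob (uniform n) fun a => TypicalCover q D ε ε₁ x a b) ≤ π := fun b =>
    (hU.prob_mono fun a ha => ha.1).trans_eq (prob_jointlyTypical_add_right b)
  have htail := prob_pairsCount_lt_le hU hq' hM₀ hM₁ hρ.symm (by linarith)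
    (prob_typicalCover_le hq hqD hlik hlik' hD hn (by linarith) x) hcolumn
  refine ((hU.codebook hq' M₀ M₁).prob_mono fun c hc => ?_).trans (htail.trans ?_)
  · refine (pairsCount_mono (fun a b h => h.1) c).trans_lt (hc.trans_le ?_)
    have := mul_le_mul_of_nonneg_left hρπ (by positivity : (0 : ℝ) ≤ M₀ * M₁)
    linarith
  · set K := (2 : ℝ) ^ (-(n * (h2 (star q D) - h2 D - 2 * δ)))
    calc 4 * (1 / (M₀ * M₁ * ρ) + K / (M₀ * ρ) + π / (M₁ * ρ))
        ≤ 4 * (1 / (M₀ * M₁ * (1 / 2 * π)) + K / (M₀ * (1 / 2 * π)) +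
            π / (M₁ * (1 / 2 * π))) := by gcongr
      _ = 8 * (1 / (M₀ * M₁ * π) + K / (M₀ * π) + 1 / M₁) := by field_simp; ring

end Covering

/-! ### Error probabilities at a fixed block length -/

section Errors

variable {n M₀ M₁ : ℕ} {p q D δ ε ε' ε₁ κ : ℝ} {x : Word n}

/-- Bound on the probability that two random codebooks with `M₀` and `M₁` codewords contain too
few pairs covering a balanced word. -/
noncomputable def coverFailureBound (q D δ : ℝ) (n M₀ M₁ : ℕ) : ℝ :=
  16 * ((2 : ℝ) ^ (n * (1 - h2 D + δ)) / (M₀ * M₁) +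
    (2 : ℝ) ^ (n * (1 - h2 (star q D) + 3 * δ)) / M₀) + 8 / M₁

lemma Balanced.prob_pairsCount_lt_le (hx : Balanced (ε / 8) x) (hq : q ∈ Set.Icc 0 1)
    (hD : D ∈ Set.Icc 0 1) (hM₀ : 0 < M₀) (hM₁ : 0 < M₁) (hqD : star q D ≠ 0)
    (hlik : LikelihoodTolerance D δ ε₁) (hlik' : LikelihoodTolerance (star q D) δ ε₁)
    (hn : 0 < n) (hε : 0 < ε) (hε₁ : ε ≤ ε₁) (hlarge : 4 / (n * (ε / 8) ^ 2) ≤ 1 / 2) :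
    (prob (codebookLaw (uniform n) (piLaw (bern q)) M₀ M₁) fun c =>
        pairsCount (fun a b => JointlyTypical ε (additiveLaw (bern D)) (a + b) x) c <
          M₀ * M₁ * typicalProb D ε x / 4) ≤ coverFailureBound q D δ n M₀ M₁ := by
  have hle := hx.le_typicalProb hD hlik hn hε (by linarith) hlarge
  set π₀ := (2 : ℝ) ^ (-(n * (1 - h2 D + δ))) with hπ₀
  set K := (2 : ℝ) ^ (-(n * (h2 (star q D) - h2 D - 2 * δ))) with hK
  have hπ₀pos : 0 < π₀ := by positivity
  have hinv : (2 : ℝ) ^ (n * (1 - h2 D + δ)) = 1 / π₀ := by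
    rw [hπ₀, one_div, Real.rpow_neg two_pos.le, inv_inv]
  have hratio : (2 : ℝ) ^ (n * (1 - h2 (star q D) + 3 * δ)) = K / π₀ := by
    rw [hK, hπ₀, ← Real.rpow_sub two_pos]
    ring_nf
  refine (prob_pairsCount_jointlyTypical_lt_le hq hD hM₀ hM₁ hqD hlik hlik' hn hε hε₁ hlarge
    (by linarith)).trans ?_
  calc 8 * (1 / (M₀ * M₁ * typicalProb D ε x) + K / (M₀ * typicalProb D ε x) + 1 / M₁)
      ≤ 8 * (1 / (M₀ * M₁ * (1 / 2 * π₀)) + K / (M₀ * (1 / 2 * π₀)) + 1 / M₁) := by gcongr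
    _ = coverFailureBound q D δ n M₀ M₁ := by
      rw [coverFailureBound, hinv, hratio]
      field_simp
      ring

/-- Covering pairs are not too few, so drawing one of them costs at most a constant factor. -/
lemma Balanced.expect_choiceProb_le (hx : Balanced (ε / 8) x) (hp : p ∈ Set.Icc 0 1)
    (hq : q ∈ Set.Icc 0 1) (hD : D ∈ Set.Icc 0 1) (hM₀ : 0 < M₀) (hM₁ : 0 < M₁)
    (hqD : star q D ≠ 0) (hlik : LikelihoodTolerance D δ ε₁)
    (hlik' : LikelihoodTolerance (star q D) δ ε₁) (hn : 0 < n) (hε : 0 < ε) (hε₁ : ε ≤ ε₁)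
    (hlarge : 4 / (n * (ε / 8) ^ 2) ≤ 1 / 2)
    {E : (Fin M₀ → Word n) × (Fin M₁ → Word n) → Word n → Fin M₀ × Fin M₁ → Prop}
    (hE : ∀ s : Fin M₀ × Fin M₁, (expect (codebookLaw (uniform n) (piLaw (bern q)) M₀ M₁) fun c =>
      prob (piLaw (bern p)) fun z =>
        JointlyTypical ε (additiveLaw (bern D)) (c.1 s.1 + c.2 s.2) x ∧ E c z s) ≤
          typicalProb D ε x * κ) :
    (expect (codebookLaw (uniform n) (piLaw (bern q)) M₀ M₁) fun c =>
      expect (piLaw (bern p)) fun z =>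
        choiceProb (fun s => JointlyTypical ε (additiveLaw (bern D)) (c.1 s.1 + c.2 s.2) x)
          (E c z)) ≤ coverFailureBound q D δ n M₀ M₁ + 4 * κ := by
  have hC := (isLaw_uniform n).codebook ((isLaw_bern hq).pi (ι := Fin n)) M₀ M₁
  have hZ := (isLaw_bern hp).pi (ι := Fin n)
  have hpos : 0 < typicalProb D ε x :=
    (by positivity : (0 : ℝ) < 1 / 2 * (2 : ℝ) ^ (-(n * (1 - h2 D + δ)))).trans_le
      (hx.le_typicalProb hD hlik hn hε (by linarith) hlarge)
  have hτ : 0 < M₀ * M₁ * typicalProb D ε x / 4 := by positivity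
  have hchoice := hC.expect_choiceProb_le hZ
    (fun c s => JointlyTypical ε (additiveLaw (bern D)) (c.1 s.1 + c.2 s.2) x) E hτ
  refine hchoice.trans (add_le_add ?_ ?_)
  · simp only [Fintype.sum_prod_type]
    exact hx.prob_pairsCount_lt_le hq hD hM₀ hM₁ hqD hlik hlik' hn hε hε₁ hlarge
  · rw [div_le_iff₀ hτ]
    refine (Finset.sum_le_sum fun s _ => hE s).trans_eq ?_
    rw [Finset.sum_const, Finset.card_univ, Fintype.card_prod, Fintype.card_fin,
      Fintype.card_fin, nsmul_eq_mul]
    push_cast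
    ring

lemma schemeProb_le (hp : p ∈ Set.Icc 0 1) (hq : q ∈ Set.Icc 0 1) (hD : D ∈ Set.Icc 0 1)
    (hM₀ : 0 < M₀) (hM₁ : 0 < M₁) (hqD : star q D ≠ 0) (hlik : LikelihoodTolerance D δ ε₁)
    (hlik' : LikelihoodTolerance (star q D) δ ε₁) (hn : 0 < n) (hε : 0 < ε) (hε₁ : ε ≤ ε₁)
    (hlarge : 4 / (n * (ε / 8) ^ 2) ≤ 1 / 2) (hκ : 0 ≤ κ)
    {E : (Fin M₀ → Word n) → (Fin M₁ → Word n) → Word n → Word n → Fin M₀ × Fin M₁ → Prop}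
    (hE : ∀ (x : Word n) (s : Fin M₀ × Fin M₁),
      (expect (codebookLaw (uniform n) (piLaw (bern q)) M₀ M₁) fun c =>
        prob (piLaw (bern p)) fun z =>
          JointlyTypical ε (additiveLaw (bern D)) (c.1 s.1 + c.2 s.2) x ∧
            E c.1 c.2 (x - z) z s) ≤ typicalProb D ε x * κ) :
    schemeProb p q D ε n M₀ M₁ E ≤
      4 / (n * (ε / 8) ^ 2) + (coverFailureBound q D δ n M₀ M₁ + 4 * κ) := by
  have hU := isLaw_uniform n
  have hC := hU.codebook ((isLaw_bern hq).pi (ι := Fin n)) M₀ M₁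
  have hZ := (isLaw_bern hp).pi (ι := Fin n)
  have hbound : 0 ≤ coverFailureBound q D δ n M₀ M₁ + 4 * κ := by
    unfold coverFailureBound
    positivity
  calc schemeProb p q D ε n M₀ M₁ E
      ≤ expect (uniform n) fun x => ind (¬Balanced (ε / 8) x) +
          (coverFailureBound q D δ n M₀ M₁ + 4 * κ) := by
        refine (schemeProb_eq E).trans_le (hU.expect_mono fun x => ?_)
        by_cases hx : Balanced (ε / 8) x
        · exact (hx.expect_choiceProb_le hp hq hD hM₀ hM₁ hqD hlik hlik' hn hε hε₁ hlarge
            (hE x)).trans (le_add_of_nonneg_left (ind_nonneg _))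
        · rw [ind_of hx]
          exact (hC.expect_le fun c => hZ.expect_le fun z => choiceProb_le_one _ _).trans
            (le_add_of_nonneg_right hbound)
    _ ≤ _ := by
        rw [expect_add, hU.expect_const]
        exact add_le_add_left (prob_not_balanced_le hn (by positivity)) _

lemma hammingNorm_sub (x u : Word n) : (hammingNorm (x - u) : ℝ) = hammingDist x u := by
  simp only [hammingNorm_eq_sum_ind, hammingDist_eq_sum_ind, Pi.sub_apply, sub_ne_zero]

lemma JointlyTypical.hammingDist_le (hn : 0 < n) (hε : 0 ≤ ε) {u : Word n}
    (h : JointlyTypical ε (additiveLaw (bern D)) u x) : hammingDist x u ≤ n * (D + ε) := by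
  have hdev := (abs_le.1 (h.pairFreqNear_sub hn).abs_hammingNorm_sub_le).2
  rw [hammingNorm_sub] at hdev
  have : (0 : ℝ) ≤ n * ε := by positivity
  linarith

lemma jointlyTypical_sub_iff (hpD : star p D ∈ Set.Ioo 0 1) (hn : 0 < n) (u b z : Word n) :
    JointlyTypical ε' (additiveLaw (conv (bern p) (bern D))) (u - b) (x - z - b) ↔
      PairFreqNear (ε' / 4) (fun _ s => 1 / 2 * conv (bern p) (bern D) s) (u - b) (x - u - z) := by
  have hne : ∀ a c, additiveLaw (conv (bern p) (bern D)) a c ≠ 0 := fun a c => by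
    rw [additiveLaw_eq, conv_bern]
    have := hpD.2
    unfold bern
    split_ifs
    · linarith
    · linarith [hpD.1]
  rw [jointlyTypical_iff hn, pairFreqNear_additiveLaw_iff, sub_sub_sub_cancel_right,
    sub_right_comm x z u]
  exact and_iff_right fun a c h => absurd h (hne a c)

lemma expect_prob_not_decTypical_le (hp : p ∈ Set.Icc 0 1) (hq : q ∈ Set.Icc 0 1)
    (hpD : star p D ∈ Set.Ioo 0 1) (hn : 0 < n) (hε : ε < ε') {u : Word n}
    (hu : JointlyTypical ε (additiveLaw (bern D)) u x) :
    (expect (piLaw (bern q)) fun b => prob (piLaw (bern p)) fun z =>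
      ¬JointlyTypical ε' (additiveLaw (conv (bern p) (bern D))) (u - b) (x - z - b)) ≤
      8 / (n * ((ε' - ε) / 8) ^ 2) := by
  have hB := (isLaw_bern hq).pi (ι := Fin n)
  have hZ := (isLaw_bern hp).pi (ι := Fin n)
  set η := 4 / (n * ((ε' - ε) / 8) ^ 2)
  let Near : Word n → Prop := fun v =>
    PairFreqNear ((ε + ε') / 8) (fun _ s => 1 / 2 * bern D s) v (x - u)
  have hshift : (prob (piLaw (bern q)) fun b => ¬Near (u - b)) ≤ η := by
    have h := (hu.pairFreqNear_sub hn).prob_not_sub_left_le (isLaw_bern hq) hn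
      (show ε / 4 < (ε + ε') / 8 by linarith)
    rwa [show (ε + ε') / 8 - ε / 4 = (ε' - ε) / 8 by ring] at h
  have hnoise : ∀ b, Near (u - b) → (prob (piLaw (bern p)) fun z =>
      ¬JointlyTypical ε' (additiveLaw (conv (bern p) (bern D))) (u - b) (x - z - b)) ≤ η :=
    fun b hb => by
      have h := hb.prob_not_sub_right_le (isLaw_bern hp) hn
        (show (ε + ε') / 8 < ε' / 4 by linarith)
      rw [show ε' / 4 - (ε + ε') / 8 = (ε' - ε) / 8 by ring] at h
      simpa only [jointlyTypical_sub_iff hpD hn] using h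
  calc (expect (piLaw (bern q)) fun b => prob (piLaw (bern p)) fun z =>
        ¬JointlyTypical ε' (additiveLaw (conv (bern p) (bern D))) (u - b) (x - z - b))
      ≤ expect (piLaw (bern q)) fun b => ind (¬Near (u - b)) + η := hB.expect_mono fun b => by
        by_cases hb : Near (u - b)
        · exact (hnoise b hb).trans (le_add_of_nonneg_left (ind_nonneg _))
        · rw [ind_of hb]
          exact (hZ.expect_le fun z => ind_le_one _).trans
            (le_add_of_nonneg_right (by positivity))
    _ ≤ η + η := by
        rw [expect_add, hB.expect_const]
        exact add_le_add_left hshift η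
    _ = 8 / (n * ((ε' - ε) / 8) ^ 2) := by ring

lemma expect_codebookLaw_prob_not_decTypical_le (hp : p ∈ Set.Icc 0 1) (hq : q ∈ Set.Icc 0 1)
    (hpD : star p D ∈ Set.Ioo 0 1) (hn : 0 < n) (hε : ε < ε') (x : Word n)
    (s : Fin M₀ × Fin M₁) :
    (expect (codebookLaw (uniform n) (piLaw (bern q)) M₀ M₁) fun c =>
      prob (piLaw (bern p)) fun z =>
        JointlyTypical ε (additiveLaw (bern D)) (c.1 s.1 + c.2 s.2) x ∧
          ¬DecTypical p D ε' c.1 (x - z - c.2 s.2) s.1) ≤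
      typicalProb D ε x * (8 / (n * ((ε' - ε) / 8) ^ 2)) := by
  have hB := (isLaw_bern hq).pi (ι := Fin n)
  simp only [DecTypical, prob_const_and]
  rw [expect_codebookLaw_apply (isLaw_uniform n) hB s.1 s.2 fun a b =>
      ind (JointlyTypical ε (additiveLaw (bern D)) (a + b) x) * prob (piLaw (bern p)) fun z =>
        ¬JointlyTypical ε' (additiveLaw (conv (bern p) (bern D))) a (x - z - b),
    expect_uniform_expect_sub, typicalProb, prob, ← expect_mul_const]
  refine (isLaw_uniform n).expect_mono fun u => ?_
  simp only [sub_add_cancel, expect_const_mul]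
  by_cases hu : JointlyTypical ε (additiveLaw (bern D)) u x
  · exact mul_le_mul_of_nonneg_left (expect_prob_not_decTypical_le hp hq hpD hn hε hu)
      (ind_nonneg _)
  · rw [ind_of_not hu, zero_mul, zero_mul]

lemma expect_codebookLaw_prob_decTypical_le (hp : p ∈ Set.Icc 0 1) (hq : q ∈ Set.Icc 0 1)
    (hpD : star p D ∈ Set.Icc 0 1) (hlik : LikelihoodTolerance (star p D) δ ε₁) (hn : 0 < n)
    (hε₁ : ε' / 2 ≤ ε₁) (x : Word n) (s : Fin M₀ × Fin M₁) {i : Fin M₀} (hi : i ≠ s.1) :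
    (expect (codebookLaw (uniform n) (piLaw (bern q)) M₀ M₁) fun c =>
      prob (piLaw (bern p)) fun z =>
        JointlyTypical ε (additiveLaw (bern D)) (c.1 s.1 + c.2 s.2) x ∧
          DecTypical p D ε' c.1 (x - z - c.2 s.2) i) ≤
      typicalProb D ε x * (2 : ℝ) ^ (-(n * (1 - h2 (star p D) - δ))) := by
  have hU := isLaw_uniform n
  have hB := ((isLaw_bern hq).pi (ι := Fin n)).pi (ι := Fin M₁)
  have hZ := (isLaw_bern hp).pi (ι := Fin n)
  have hcodebook : ∀ (c₁ : Fin M₁ → Word n) (z : Word n),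
      (expect (piLaw (uniform n)) fun c₀ : Fin M₀ → Word n =>
        ind (JointlyTypical ε (additiveLaw (bern D)) (c₀ s.1 + c₁ s.2) x ∧
          DecTypical p D ε' c₀ (x - z - c₁ s.2) i)) =
        typicalProb D ε x * typicalProb (star p D) ε' (x - z - c₁ s.2) := fun c₁ z => by
    simp only [ind_and, DecTypical, conv_bern]
    rw [hU.expect_piLaw_mul_apply hi.symm
      (fun a => ind (JointlyTypical ε (additiveLaw (bern D)) (a + c₁ s.2) x))
      fun a => ind (JointlyTypical ε' (additiveLaw (bern (star p D))) a (x - z - c₁ s.2))]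
    exact congrArg (· * _) (prob_jointlyTypical_add_right (c₁ s.2))
  rw [expect_codebookLaw, expect_comm]
  refine hB.expect_le fun c₁ => ?_
  simp only [prob]
  rw [expect_comm]
  refine hZ.expect_le fun z => (hcodebook c₁ z).trans_le ?_
  exact mul_le_mul_of_nonneg_left (typicalProb_le hpD hlik hn hε₁ _) (hU.prob_nonneg _)

lemma expect_codebookLaw_prob_ne_and_decTypical_le (hp : p ∈ Set.Icc 0 1) (hq : q ∈ Set.Icc 0 1)
    (hpD : star p D ∈ Set.Icc 0 1) (hlik : LikelihoodTolerance (star p D) δ ε₁) (hn : 0 < n)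
    (hε₁ : ε' / 2 ≤ ε₁) (x : Word n) (s : Fin M₀ × Fin M₁) (i : Fin M₀) :
    (expect (codebookLaw (uniform n) (piLaw (bern q)) M₀ M₁) fun c =>
      prob (piLaw (bern p)) fun z => i ≠ s.1 ∧
        JointlyTypical ε (additiveLaw (bern D)) (c.1 s.1 + c.2 s.2) x ∧
          DecTypical p D ε' c.1 (x - z - c.2 s.2) i) ≤
      typicalProb D ε x * (2 : ℝ) ^ (-(n * (1 - h2 (star p D) - δ))) := by
  simp only [prob_const_and (piLaw (bern p)) (i ≠ s.1), expect_const_mul]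
  by_cases hi : i ≠ s.1
  · rw [ind_of hi, one_mul]
    exact expect_codebookLaw_prob_decTypical_le hp hq hpD hlik hn hε₁ x s hi
  · rw [ind_of_not hi, zero_mul]
    exact mul_nonneg ((isLaw_uniform n).prob_nonneg _) (by positivity)

lemma expect_codebookLaw_prob_decError_le (hp : p ∈ Set.Icc 0 1) (hq : q ∈ Set.Icc 0 1)
    (hpD : star p D ∈ Set.Ioo 0 1) (hlik : LikelihoodTolerance (star p D) δ ε₁) (hn : 0 < n)
    (hε : ε < ε') (hε₁ : ε' / 2 ≤ ε₁) (x : Word n) (s : Fin M₀ × Fin M₁) :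
    (expect (codebookLaw (uniform n) (piLaw (bern q)) M₀ M₁) fun c =>
      prob (piLaw (bern p)) fun z =>
        JointlyTypical ε (additiveLaw (bern D)) (c.1 s.1 + c.2 s.2) x ∧
          ¬(DecTypical p D ε' c.1 (x - z - c.2 s.2) s.1 ∧
            ∀ i, DecTypical p D ε' c.1 (x - z - c.2 s.2) i → i = s.1)) ≤
      typicalProb D ε x * (8 / (n * ((ε' - ε) / 8) ^ 2) +
        M₀ * (2 : ℝ) ^ (-(n * (1 - h2 (star p D) - δ)))) := by
  have hC := (isLaw_uniform n).codebook ((isLaw_bern hq).pi (ι := Fin n)) M₀ M₁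
  have hZ := (isLaw_bern hp).pi (ι := Fin n)
  let Cov : (Fin M₀ → Word n) × (Fin M₁ → Word n) → Prop := fun c =>
    JointlyTypical ε (additiveLaw (bern D)) (c.1 s.1 + c.2 s.2) x
  let Dec : (Fin M₀ → Word n) × (Fin M₁ → Word n) → Word n → Fin M₀ → Prop := fun c z =>
    DecTypical p D ε' c.1 (x - z - c.2 s.2)
  calc (expect (codebookLaw (uniform n) (piLaw (bern q)) M₀ M₁) fun c =>
        prob (piLaw (bern p)) fun z =>
          Cov c ∧ ¬(Dec c z s.1 ∧ ∀ i, Dec c z i → i = s.1))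
      ≤ expect (codebookLaw (uniform n) (piLaw (bern q)) M₀ M₁) fun c =>
          (prob (piLaw (bern p)) fun z => Cov c ∧ ¬Dec c z s.1) +
            ∑ i, prob (piLaw (bern p)) fun z => i ≠ s.1 ∧ Cov c ∧ Dec c z i := by
        refine hC.expect_mono fun c => (hZ.prob_mono fun z hz => ?_).trans
          ((hZ.prob_or_le _ _).trans (add_le_add_right (hZ.prob_exists_le_sum _) _))
        by_cases hs : Dec c z s.1
        · have hother : ¬∀ i, Dec c z i → i = s.1 := fun h => hz.2 ⟨hs, h⟩
          push Not at hother
          obtain ⟨i, hi, hne⟩ := hother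
          exact Or.inr ⟨i, hne, hz.1, hi⟩
        · exact Or.inl ⟨hz.1, hs⟩
    _ ≤ typicalProb D ε x * (8 / (n * ((ε' - ε) / 8) ^ 2)) +
          ∑ _i : Fin M₀, typicalProb D ε x * (2 : ℝ) ^ (-(n * (1 - h2 (star p D) - δ))) := by
        rw [expect_add, expect_sum]
        exact add_le_add (expect_codebookLaw_prob_not_decTypical_le hp hq hpD hn hε x s)
          (Finset.sum_le_sum fun i _ => expect_codebookLaw_prob_ne_and_decTypical_le hp hq
            (Set.Ioo_subset_Icc_self hpD) hlik hn hε₁ x s i)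
    _ = _ := by
        rw [Finset.sum_const, Finset.card_univ, Fintype.card_fin, nsmul_eq_mul]
        ring

end Errors

/-! ### Error probabilities as the block length grows -/

section Limits

variable {n : ℕ} {p q D δ ε ε' ε₁ a R R₀ R₁ : ℝ}

lemma schemeProb_nonneg {M₀ M₁ : ℕ} (hp : p ∈ Set.Icc 0 1) (hq : q ∈ Set.Icc 0 1)
    (E : (Fin M₀ → Word n) → (Fin M₁ → Word n) → Word n → Word n → Fin M₀ × Fin M₁ → Prop) :
    0 ≤ schemeProb p q D ε n M₀ M₁ E := by
  have hU := isLaw_uniform n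
  rw [schemeProb_eq]
  exact hU.expect_nonneg fun x => (hU.codebook (isLaw_bern hq).pi M₀ M₁).expect_nonneg fun c =>
    (isLaw_bern hp).pi.expect_nonneg fun z => choiceProb_nonneg _ _

lemma two_rpow_le_codeSize (R : ℝ) (n : ℕ) : (2 : ℝ) ^ (n * R) ≤ codeSize R n := Nat.le_ceil _

lemma codeSize_pos (R : ℝ) (n : ℕ) : 0 < codeSize R n := Nat.ceil_pos.2 (by positivity)

lemma codeSize_le (hR : 0 ≤ R) (n : ℕ) : (codeSize R n : ℝ) ≤ 2 * (2 : ℝ) ^ (n * R) := by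
  rw [two_mul]
  exact (Nat.ceil_lt_add_one (by positivity)).le.trans
    (add_le_add_right (Real.one_le_rpow one_le_two (by positivity)) _)

lemma encErrorProb_le (hp : p ∈ Set.Icc 0 1) (hq : q ∈ Set.Icc 0 1) (hD : D ∈ Set.Icc 0 1)
    (hqD : star q D ≠ 0) (hlik : LikelihoodTolerance D δ ε₁)
    (hlik' : LikelihoodTolerance (star q D) δ ε₁) (hn : 0 < n) (hε : 0 < ε) (hε₁ : ε ≤ ε₁)
    (hlarge : 4 / (n * (ε / 8) ^ 2) ≤ 1 / 2) :
    encErrorProb p q D R₀ R₁ ε n ≤ 4 / (n * (ε / 8) ^ 2) +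
      coverFailureBound q D δ n (codeSize R₀ n) (codeSize R₁ n) := by
  refine (schemeProb_le hp hq hD (codeSize_pos R₀ n) (codeSize_pos R₁ n) hqD hlik hlik' hn hε hε₁
    hlarge le_rfl fun x s => ?_).trans_eq (by rw [mul_zero, add_zero])
  have hnever : ∀ u z : Word n, ¬(JointlyTypical ε (additiveLaw (bern D)) u x ∧
      n * (D + ε) < hammingDist (x - z + z) u) := fun u z h => by
    have hclose := h.1.hammingDist_le hn hε.le
    rw [sub_add_cancel] at h
    exact hclose.not_gt h.2
  simp only [prob, ind_of_not (hnever _ _), expect, mul_zero, Finset.sum_const_zero, le_refl]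

lemma decErrorProb_le (hp : p ∈ Set.Icc 0 1) (hq : q ∈ Set.Icc 0 1) (hD : D ∈ Set.Icc 0 1)
    (hpD : star p D ∈ Set.Ioo 0 1) (hqD : star q D ≠ 0) (hlik : LikelihoodTolerance D δ ε₁)
    (hlik' : LikelihoodTolerance (star q D) δ ε₁) (hlik'' : LikelihoodTolerance (star p D) δ ε₁)
    (hn : 0 < n) (hε : 0 < ε) (hεε' : ε < ε') (hε' : ε' ≤ ε₁)
    (hlarge : 4 / (n * (ε / 8) ^ 2) ≤ 1 / 2) :
    decErrorProb p q D R₀ R₁ ε ε' n ≤ 4 / (n * (ε / 8) ^ 2) +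
      (coverFailureBound q D δ n (codeSize R₀ n) (codeSize R₁ n) +
        4 * (8 / (n * ((ε' - ε) / 8) ^ 2) +
          codeSize R₀ n * (2 : ℝ) ^ (-(n * (1 - h2 (star p D) - δ))))) :=
  schemeProb_le hp hq hD (codeSize_pos R₀ n) (codeSize_pos R₁ n) hqD hlik hlik' hn hε
    (hεε'.le.trans hε') hlarge (by positivity)
    (expect_codebookLaw_prob_decError_le hp hq hpD hlik'' hn hεε' (by linarith))

lemma tendsto_const_div_natCast_mul (c C : ℝ) :
    Tendsto (fun n : ℕ => C / (n * c)) atTop (𝓝 0) :=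
  (tendsto_const_div_atTop_nhds_zero_nat (C / c)).congr fun n => by rw [div_div, mul_comm]

lemma tendsto_two_rpow_neg_natCast_mul (hδ : 0 < δ) :
    Tendsto (fun n : ℕ => (2 : ℝ) ^ (-(n * δ))) atTop (𝓝 0) := by
  have hlt : (2 : ℝ) ^ (-δ) < 1 := Real.rpow_lt_one_of_one_lt_of_neg one_lt_two (neg_lt_zero.2 hδ)
  refine (tendsto_pow_atTop_nhds_zero_of_lt_one (by positivity) hlt).congr fun n => ?_
  rw [← Real.rpow_natCast, ← Real.rpow_mul two_pos.le, neg_mul, mul_comm]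

lemma tendsto_two_rpow_div {M : ℕ → ℝ} (ha : a < R) (hM : ∀ n : ℕ, (2 : ℝ) ^ (n * R) ≤ M n) :
    Tendsto (fun n : ℕ => (2 : ℝ) ^ (n * a) / M n) atTop (𝓝 0) := by
  have hpos : ∀ n : ℕ, 0 < M n := fun n => lt_of_lt_of_le (by positivity) (hM n)
  refine squeeze_zero (fun n => div_nonneg (by positivity) (hpos n).le) (fun n => ?_)
    (tendsto_two_rpow_neg_natCast_mul (sub_pos.2 ha))
  rw [div_le_iff₀ (hpos n)]
  calc (2 : ℝ) ^ (n * a) = (2 : ℝ) ^ (-(n * (R - a))) * (2 : ℝ) ^ (n * R) := by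
        rw [← Real.rpow_add two_pos]; ring_nf
    _ ≤ (2 : ℝ) ^ (-(n * (R - a))) * M n := by gcongr; exact hM n

lemma tendsto_codeSize_mul_two_rpow_neg (hR : 0 ≤ R) (ha : R < a) :
    Tendsto (fun n : ℕ => (codeSize R n : ℝ) * (2 : ℝ) ^ (-(n * a))) atTop (𝓝 0) := by
  have hlim := (tendsto_two_rpow_neg_natCast_mul (sub_pos.2 ha)).const_mul 2
  rw [mul_zero] at hlim
  refine squeeze_zero (fun n => by positivity) (fun n => ?_) hlim
  calc (codeSize R n : ℝ) * (2 : ℝ) ^ (-(n * a))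
      ≤ 2 * (2 : ℝ) ^ (n * R) * (2 : ℝ) ^ (-(n * a)) := by gcongr; exact codeSize_le hR n
    _ = 2 * (2 : ℝ) ^ (-(n * (a - R))) := by
      rw [mul_assoc, ← Real.rpow_add two_pos]; ring_nf

lemma tendsto_coverFailureBound (hR₁ : 0 < R₁) (hsum : 1 - h2 D + δ < R₀ + R₁)
    (hR₀ : 1 - h2 (star q D) + 3 * δ < R₀) :
    Tendsto (fun n => coverFailureBound q D δ n (codeSize R₀ n) (codeSize R₁ n)) atTop (𝓝 0) := by
  have hpair := tendsto_two_rpow_div (M := fun n => (codeSize R₀ n : ℝ) * codeSize R₁ n) hsum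
    fun n => by
      rw [mul_add, Real.rpow_add two_pos]
      gcongr
      exacts [two_rpow_le_codeSize R₀ n, two_rpow_le_codeSize R₁ n]
  have hsingle := tendsto_two_rpow_div hR₀ (two_rpow_le_codeSize R₀)
  have hsecond := tendsto_two_rpow_div hR₁ (two_rpow_le_codeSize R₁)
  simpa [coverFailureBound, div_eq_mul_inv] using
    ((hpair.add hsingle).const_mul 16).add (hsecond.const_mul 8)

lemma exists_rate_slack (hq : 1 - h2 (star q D) < R₀) (hD : 1 - h2 D < R₀ + R₁)
    (hp : R₀ < 1 - h2 (star p D)) :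
    ∃ δ > 0, 1 - h2 (star q D) + 3 * δ < R₀ ∧ 1 - h2 D + δ < R₀ + R₁ ∧
      R₀ < 1 - h2 (star p D) - δ := by
  have hev : ∀ᶠ δ : ℝ in 𝓝 0, 1 - h2 (star q D) + 3 * δ < R₀ ∧ 1 - h2 D + δ < R₀ + R₁ ∧
      R₀ < 1 - h2 (star p D) - δ :=
    (ContinuousAt.eventually_lt (by fun_prop) continuousAt_const (by simpa using hq)).and <|
      (ContinuousAt.eventually_lt (by fun_prop) continuousAt_const (by simpa using hD)).and <|
        ContinuousAt.eventually_lt continuousAt_const (by fun_prop) (by simpa using hp)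
  obtain ⟨δ, hδ, hpos⟩ := ((hev.filter_mono nhdsWithin_le_nhds).and self_mem_nhdsWithin).exists
    (f := 𝓝[>] 0)
  exact ⟨δ, hpos, hδ⟩

lemma exists_tendsto_errorProb (hp : p ∈ Set.Ioo 0 1) (hq : q ∈ Set.Icc 0 1)
    (hD : D ∈ Set.Ico 0 1) (hD' : D ≠ 1 / 2) (hpq : h2 (star p D) < h2 (star q D))
    (hR : (R₀, R₁) ∈ rateRegion p q D) (hR₀ : R₀ < 1 - h2 (star p D)) :
    ∃ ε₀ : ℝ, 0 < ε₀ ∧ ∀ ε ε' : ℝ, 0 < ε → ε < ε' → ε' < ε₀ →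
      Tendsto (encErrorProb p q D R₀ R₁ ε) atTop (𝓝 0) ∧
      Tendsto (decErrorProb p q D R₀ R₁ ε ε') atTop (𝓝 0) := by
  have hp01 := Set.Ioo_subset_Icc_self hp
  have hD01 := Set.Ico_subset_Icc_self hD
  have hpD := star_mem_Ioo hp hD01
  have hqD := star_mem_Ioo_of_h2_lt hp01 hq hD01 hpq
  obtain ⟨hRq, hRD, -⟩ := mem_rateRegion.1 hR
  have hR₀pos : 0 ≤ R₀ := (sub_nonneg.2 (h2_le_one _)).trans hRq.le
  have hR₁pos : 0 < R₁ := (R1star_pos hp hD01 hD').trans (R1star_lt_of_mem_rateRegion hR)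
  obtain ⟨δ, hδ, hδq, hδD, hδp⟩ := exists_rate_slack hRq hRD hR₀
  obtain ⟨η, hη, hlik⟩ := exists_likelihoodTolerance hD hδ
  obtain ⟨η', hη', hlik'⟩ := exists_likelihoodTolerance (Set.Ioo_subset_Ico_self hqD) hδ
  obtain ⟨η'', hη'', hlik''⟩ := exists_likelihoodTolerance (Set.Ioo_subset_Ico_self hpD) hδ
  refine ⟨min η (min η' η''), by positivity, fun ε ε' hε hεε' hε' => ?_⟩
  replace hlik := hlik.mono (hε'.le.trans (min_le_left _ _))
  replace hlik' := hlik'.mono (hε'.le.trans ((min_le_right _ _).trans (min_le_left _ _)))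
  replace hlik'' := hlik''.mono (hε'.le.trans ((min_le_right _ _).trans (min_le_right _ _)))
  have hbalance := tendsto_const_div_natCast_mul ((ε / 8) ^ 2) 4
  have hcover := tendsto_coverFailureBound hR₁pos hδD hδq
  have hdecode := (tendsto_const_div_natCast_mul (((ε' - ε) / 8) ^ 2) 8).add
    (tendsto_codeSize_mul_two_rpow_neg hR₀pos hδp)
  have hlarge := (hbalance.eventually (ge_mem_nhds (by norm_num : (0 : ℝ) < 1 / 2))).and
    (eventually_gt_atTop 0)
  constructor
  · refine squeeze_zero' (.of_forall fun n => schemeProb_nonneg hp01 hq _)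
      (hlarge.mono fun n hn => encErrorProb_le hp01 hq hD01 hqD.1.ne' hlik hlik' hn.2 hε
        hεε'.le hn.1) ?_
    simpa only [add_zero] using hbalance.add hcover
  · refine squeeze_zero' (.of_forall fun n => schemeProb_nonneg hp01 hq _)
      (hlarge.mono fun n hn => decErrorProb_le hp01 hq hD01 hpD hqD.1.ne' hlik hlik' hlik'' hn.2
        hε hεε' le_rfl hn.1) ?_
    simpa only [add_zero, mul_zero] using
      hbalance.add (hcover.add (hdecode.const_mul 4))

end Limits

/-! ### Fixed superposition codes -/

section FixedCodes

lemma orAll_nonempty {α : Type} [Fintype α] [Nonempty α] (A : α → Prop) : (orAll A).Nonempty := by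
  unfold orAll
  split_ifs with h
  · simpa only [Finset.filter_nonempty_iff, Finset.mem_univ, true_and] using h
  · exact Finset.univ_nonempty

lemma mem_orAll_iff_of_exists {α : Type} [Fintype α] {A : α → Prop} (h : ∃ a, A a) {a : α} :
    a ∈ orAll A ↔ A a := by
  classical rw [orAll, if_pos h, Finset.mem_filter_univ]

lemma choiceProb_eq_sum_div {σ : Type} [Fintype σ] (F S : σ → Prop) :
    choiceProb F S = (∑ s ∈ orAll F, ind (S s)) / (orAll F).card := by
  classical rw [choiceProb, Finset.natCast_card_filter]; rfl

lemma choiceProb_or_le {σ : Type} [Fintype σ] (F S S' : σ → Prop) :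
    choiceProb F (fun s => S s ∨ S' s) ≤ choiceProb F S + choiceProb F S' := by
  simp only [choiceProb_eq_sum_div, ← add_div, ← Finset.sum_add_distrib]
  gcongr
  exact ind_or_le _ _

lemma exists_mem_orAll_prob_le {A σ : Type} [Fintype A] [Fintype σ] [Nonempty σ] (w : A → ℝ)
    (F : σ → Prop) (S : A → σ → Prop) :
    ∃ s ∈ orAll F, (prob w fun a => S a s) ≤ expect w fun a => choiceProb F (S a) := by
  have hcard : ((orAll F).card : ℝ) ≠ 0 := Nat.cast_ne_zero.2 (orAll_nonempty F).card_ne_zero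
  refine Finset.exists_le_of_sum_le (orAll_nonempty F) (le_of_eq ?_)
  rw [Finset.sum_const, nsmul_eq_mul, ← expect_const_mul]
  simp only [choiceProb_eq_sum_div, mul_div_cancel₀ _ hcard, prob, expect, Finset.mul_sum]
  exact Finset.sum_comm

variable {n M₀ M₁ : ℕ} {p q D ε ε' R₀ R₁ : ℝ}

lemma schemeProb_or_le (hp : p ∈ Set.Icc 0 1) (hq : q ∈ Set.Icc 0 1)
    (E E' : (Fin M₀ → Word n) → (Fin M₁ → Word n) → Word n → Word n → Fin M₀ × Fin M₁ → Prop) :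
    (schemeProb p q D ε n M₀ M₁ fun c₀ c₁ y z s => E c₀ c₁ y z s ∨ E' c₀ c₁ y z s) ≤
      schemeProb p q D ε n M₀ M₁ E + schemeProb p q D ε n M₀ M₁ E' := by
  have hU := isLaw_uniform n
  have hC := hU.codebook ((isLaw_bern hq).pi (ι := Fin n)) M₀ M₁
  have hZ := (isLaw_bern hp).pi (ι := Fin n)
  simp only [schemeProb_eq, ← expect_add]
  exact hU.expect_mono fun x => hC.expect_mono fun c => hZ.expect_mono fun z =>
    choiceProb_or_le _ _ _

lemma exists_expect_prob_le_schemeProb (hM₀ : 0 < M₀) (hM₁ : 0 < M₁) (hq : q ∈ Set.Icc 0 1)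
    (E : (Fin M₀ → Word n) → (Fin M₁ → Word n) → Word n → Word n → Fin M₀ × Fin M₁ → Prop) :
    ∃ (c₀ : Fin M₀ → Word n) (c₁ : Fin M₁ → Word n) (s : Word n → Fin M₀ × Fin M₁),
      (∀ x, s x ∈ encChoices D ε c₀ c₁ x) ∧
      (expect (uniform n) fun x => prob (piLaw (bern p)) fun z => E c₀ c₁ (x - z) z (s x)) ≤
        schemeProb p q D ε n M₀ M₁ E := by
  have := Fin.pos_iff_nonempty.1 hM₀
  have := Fin.pos_iff_nonempty.1 hM₁
  have hU := isLaw_uniform n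
  have hC := hU.codebook ((isLaw_bern hq).pi (ι := Fin n)) M₀ M₁
  have haverage := (schemeProb_eq (p := p) (q := q) (D := D) (ε := ε) E).ge
  rw [expect_comm] at haverage
  obtain ⟨⟨c₀, c₁⟩, hc⟩ := hC.exists_le_of_expect_le haverage
  choose s hs hsE using fun x => exists_mem_orAll_prob_le (piLaw (bern p))
    (fun s => JointlyTypical ε (additiveLaw (bern D)) (c₀ s.1 + c₁ s.2) x)
    fun z => E c₀ c₁ (x - z) z
  exact ⟨c₀, c₁, s, hs, (hU.expect_mono hsE).trans hc⟩

/-- The superposition code with codebooks `c₀` and `c₁`, in which the encoder selects the pair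
`s x` for the source word `x`, and the decoder the index `T w` for `w = y - c₁`. -/
def superpositionCode (c₀ : Fin M₀ → Word n) (c₁ : Fin M₁ → Word n)
    (s : Word n → Fin M₀ × Fin M₁) (T : Word n → Fin M₀) : WZCode n (Fin M₁) where
  enc x := (s x).2
  dec j y := y + (c₀ (T (y - c₁ j)) - (y - c₁ j))

variable {c₀ : Fin M₀ → Word n} {c₁ : Fin M₁ → Word n} {s : Word n → Fin M₀ × Fin M₁}
  {T : Word n → Fin M₀}

lemma isSuperpositionCode_superpositionCode (hs : ∀ x, s x ∈ encChoices D ε c₀ c₁ x)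
    (hT : ∀ w, T w ∈ decChoices p D ε' c₀ w) :
    IsSuperpositionCode p D ε ε' M₀ (superpositionCode c₀ c₁ s T) :=
  ⟨c₀, c₁, s, T, hs, hT, fun _ => rfl, fun _ _ => rfl⟩

lemma exists_isSuperpositionCode (p D ε ε' : ℝ) (n : ℕ) (hM₀ : 0 < M₀) (hM₁ : 0 < M₁) :
    ∃ C : WZCode n (Fin M₁), IsSuperpositionCode p D ε ε' M₀ C := by
  have := Fin.pos_iff_nonempty.1 hM₀
  have := Fin.pos_iff_nonempty.1 hM₁
  let c₀ : Fin M₀ → Word n := 0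
  let c₁ : Fin M₁ → Word n := 0
  choose s hs using fun x : Word n => (orAll_nonempty _ : (encChoices D ε c₀ c₁ x).Nonempty)
  choose T hT using fun w : Word n => (orAll_nonempty _ : (decChoices p D ε' c₀ w).Nonempty)
  exact ⟨_, isSuperpositionCode_superpositionCode hs hT⟩

lemma hammingDist_superpositionCode_le (hn : 0 < n) (hD : 0 ≤ D + ε)
    (hT : ∀ w, T w ∈ decChoices p D ε' c₀ w) (x y : Word n) :
    (hammingDist x ((superpositionCode c₀ c₁ s T).dec ((superpositionCode c₀ c₁ s T).enc x) y)
        : ℝ) / n ≤ D + ε +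
      ind ((n : ℝ) * (D + ε) < hammingDist x (c₀ (s x).1 + c₁ (s x).2) ∨
        ¬(DecTypical p D ε' c₀ (y - c₁ (s x).2) (s x).1 ∧
          ∀ i, DecTypical p D ε' c₀ (y - c₁ (s x).2) i → i = (s x).1)) := by
  have hn' : (0 : ℝ) < n := Nat.cast_pos.2 hn
  by_cases herr : (n : ℝ) * (D + ε) < hammingDist x (c₀ (s x).1 + c₁ (s x).2) ∨
      ¬(DecTypical p D ε' c₀ (y - c₁ (s x).2) (s x).1 ∧
        ∀ i, DecTypical p D ε' c₀ (y - c₁ (s x).2) i → i = (s x).1)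
  · rw [ind_of herr]
    refine (div_le_one_of_le₀ ?_ hn'.le).trans (le_add_of_nonneg_left hD)
    exact_mod_cast hammingDist_le_card_fintype.trans_eq (Fintype.card_fin n)
  · rw [ind_of_not herr, add_zero, div_le_iff₀ hn', mul_comm (D + ε)]
    rw [not_or, not_lt, not_not] at herr
    obtain ⟨hdist, htyp, huniq⟩ := herr
    have hTs : T (y - c₁ (s x).2) = (s x).1 :=
      huniq _ ((mem_orAll_iff_of_exists ⟨_, htyp⟩).1 (hT _))
    have hdec : y + (c₀ (T (y - c₁ (s x).2)) - (y - c₁ (s x).2)) = c₀ (s x).1 + c₁ (s x).2 := by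
      rw [hTs]
      abel
    exact (congrArg (fun u => (hammingDist x u : ℝ)) hdec).trans_le hdist

/-- Without an error the distortion is at most `D + ε`, and it never exceeds `1`. -/
lemma exists_isSuperpositionCode_distortion_le (hn : 0 < n) (hp : p ∈ Set.Icc 0 1)
    (hq : q ∈ Set.Icc 0 1) (hD : 0 ≤ D + ε) :
    ∃ C : WZCode n (Fin (codeSize R₁ n)), IsSuperpositionCode p D ε ε' (codeSize R₀ n) C ∧
      C.distortion p ≤
        D + ε + (encErrorProb p q D R₀ R₁ ε n + decErrorProb p q D R₀ R₁ ε ε' n) := by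
  have hU := isLaw_uniform n
  have hZ := (isLaw_bern hp).pi (ι := Fin n)
  have := Fin.pos_iff_nonempty.1 (codeSize_pos R₀ n)
  obtain ⟨c₀, c₁, s, hs, hle⟩ := exists_expect_prob_le_schemeProb (p := p) (q := q) (D := D)
    (ε := ε) (codeSize_pos R₀ n) (codeSize_pos R₁ n) hq fun c₀ c₁ y z s =>
      (n : ℝ) * (D + ε) < hammingDist (y + z) (c₀ s.1 + c₁ s.2) ∨
        ¬(DecTypical p D ε' c₀ (y - c₁ s.2) s.1 ∧
          ∀ i, DecTypical p D ε' c₀ (y - c₁ s.2) i → i = s.1)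
  choose T hT using fun w : Word n => (orAll_nonempty _ : (decChoices p D ε' c₀ w).Nonempty)
  refine ⟨superpositionCode c₀ c₁ s T, isSuperpositionCode_superpositionCode hs hT, ?_⟩
  rw [WZCode.distortion_eq_expect_source]
  simp only [sub_add_cancel] at hle
  refine (hU.expect_mono fun x => hZ.expect_mono fun z =>
    hammingDist_superpositionCode_le hn hD hT x (x - z)).trans ?_
  simp only [expect_add, hZ.expect_const, hU.expect_const]
  exact add_le_add_right (hle.trans (schemeProb_or_le hp hq _ _)) _

end FixedCodes

/-! ### Time-sharing -/

section TimeSharing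

lemma expect_piLaw_append {A : Type*} [Fintype A] {m k : ℕ} (w : A → ℝ)
    (f : (Fin (m + k) → A) → ℝ) :
    expect (piLaw w) f =
      expect (piLaw w) fun u => expect (piLaw w) fun v => f (Fin.append u v) := by
  simp only [expect, Finset.mul_sum, ← (Fin.appendEquiv m k).sum_comp, Fintype.sum_prod_type,
    Fin.appendEquiv, Equiv.coe_fn_mk, piLaw, Fin.prod_univ_add, Fin.append_left, Fin.append_right,
    mul_assoc]

lemma hammingDist_append {m k : ℕ} (x : Word (m + k)) (u : Word m) (v : Word k) :
    hammingDist x (Fin.append u v : Word (m + k)) =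
      hammingDist (fun i => x (Fin.castAdd k i)) u +
        hammingDist (fun i => x (Fin.natAdd m i)) v := by
  simp only [hammingDist, Finset.card_filter, Fin.sum_univ_add, Fin.append_left, Fin.append_right]

variable {m k n : ℕ} {M M' : Type} {p q t : ℝ}

lemma WZCode.mul_distortion (C : WZCode n M) (p : ℝ) :
    n * C.distortion p = expect (uniform n) fun y => expect (piLaw (bern p)) fun z =>
      (hammingDist (y + z) (C.dec (C.enc (y + z)) y) : ℝ) := by
  have hcancel : ∀ x x' : Word n, n * ((hammingDist x x' : ℝ) / n) = hammingDist x x' :=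
    fun x x' => by
      rcases n.eq_zero_or_pos with rfl | hn
      · simp [Subsingleton.elim x x']
      · exact mul_div_cancel₀ _ (Nat.cast_ne_zero.2 hn.ne')
  simp only [C.distortion_eq_expect_sideInfo, ← expect_const_mul, hcancel]

lemma mul_distortion_timeShare (C : WZCode m M) (C' : WZCode k M') (hp : p ∈ Set.Icc 0 1) :
    ((m + k : ℕ) : ℝ) * (timeShare C C').distortion p =
      m * C.distortion p + k * C'.distortion p := by
  have hZ : ∀ n, IsLaw (piLaw (bern p) : Word n → ℝ) := fun n => (isLaw_bern hp).pi
  simp only [WZCode.mul_distortion, uniform, expect_piLaw_append (m := m) (k := k), timeShare,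
    hammingDist_append, Pi.add_apply, Fin.append_left, Fin.append_right]
  push_cast
  simp only [expect_add, (hZ _).expect_const, (isLaw_bern half_mem_Icc).pi.expect_const]
  rfl

lemma mul_distortion_sideInfoCode (hp : p ∈ Set.Icc 0 1) (k : ℕ) :
    k * (sideInfoCode k).distortion p = k * p := by
  have hletter : (expect (bern p) fun a => ind (a ≠ 0)) = p := by
    rw [expect, sum_zmod_two]
    simp [ind]
  have hweight : (expect (piLaw (bern p)) fun z : Word k => (hammingNorm z : ℝ)) = k * p := by
    simp only [hammingNorm_eq_sum_ind]
    rw [(isLaw_bern hp).expect_piLaw_sum fun _ a => ind (a ≠ 0)]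
    simp only [hletter, Finset.sum_const, Finset.card_univ, Fintype.card_fin, nsmul_eq_mul]
  have hdist : ∀ y z : Word k, hammingDist (y + z) y = hammingNorm z := fun y z => by
    rw [hammingDist_comm, hammingDist_eq_hammingNorm, neg_add_cancel_left]
  simp only [WZCode.mul_distortion, sideInfoCode, hdist, hweight, (isLaw_uniform k).expect_const]

lemma distortion_timeShare_sideInfoCode_le (hp : p ∈ Set.Icc 0 1) {d : ℝ} (hd : 0 ≤ d)
    (hn : 0 < n) (hmn : m ≤ n) (hm : m ≤ t * n) (hm' : t * n ≤ m + 1) {C : WZCode m M}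
    (hC : m * C.distortion p ≤ m * d) :
    (timeShare C (sideInfoCode (n - m))).distortion p ≤ t * d + (1 - t) * p + 1 / n := by
  have hn' : (0 : ℝ) < n := Nat.cast_pos.2 hn
  have hmul := mul_distortion_timeShare C (sideInfoCode (n - m)) hp
  have hlength : ((m + (n - m) : ℕ) : ℝ) = n := congrArg _ (Nat.add_sub_cancel' hmn)
  rw [mul_distortion_sideInfoCode hp, hlength, Nat.cast_sub hmn] at hmul
  have hround : (t * n - m) * (p - d) ≤ 1 := by nlinarith [hp.1, hp.2]
  refine le_of_mul_le_mul_left ?_ hn'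
  rw [mul_add, mul_one_div_cancel hn'.ne', hmul]
  linarith

end TimeSharing

/-! ### Achievability -/

section Achievability

variable {p q D D' R₀ R₁ ε ε' t η : ℝ} {n : ℕ}

lemma exists_isSuperpositionCode_parameters (hp : p ∈ Set.Ioo 0 1) (hq : q ∈ Set.Icc 0 1)
    (hD : D ∈ Set.Ico 0 1) (hD' : D ≠ 1 / 2) (hpq : h2 (star p D) < h2 (star q D)) (hη : 0 < η) :
    ∃ R₀ ε ε' : ℝ, (R₀, R1star p D + η) ∈ rateRegion p q D ∧ 0 < ε ∧ ε < ε' ∧ ε' < η ∧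
      ∀ᶠ n : ℕ in atTop, ∃ C : WZCode n (Fin (codeSize (R1star p D + η) n)),
        IsSuperpositionCode p D ε ε' (codeSize R₀ n) C ∧ C.distortion p ≤ D + η := by
  obtain ⟨R₀, hR, hR₀⟩ := exists_mem_rateRegion_lt hpq (lt_add_of_pos_right (R1star p D) hη)
  obtain ⟨ε₀, hε₀, hlimits⟩ := exists_tendsto_errorProb hp hq hD hD' hpq hR hR₀
  obtain ⟨ε', hε'pos, hε'⟩ := exists_between (lt_min hε₀ (half_pos hη))
  obtain ⟨hε'ε₀, hε'η⟩ := lt_min_iff.1 hε'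
  obtain ⟨henc, hdec⟩ := hlimits (ε' / 2) ε' (half_pos hε'pos) (half_lt_self hε'pos) hε'ε₀
  refine ⟨R₀, ε' / 2, ε', hR, half_pos hε'pos, half_lt_self hε'pos, by linarith, ?_⟩
  have herr : ∀ᶠ n in atTop, encErrorProb p q D R₀ (R1star p D + η) (ε' / 2) n +
      decErrorProb p q D R₀ (R1star p D + η) (ε' / 2) ε' n < η / 2 :=
    (henc.add hdec).eventually_lt_const (by linarith)
  filter_upwards [herr, eventually_gt_atTop 0] with n herr hn
  obtain ⟨C, hC, hdist⟩ := exists_isSuperpositionCode_distortion_le (p := p) (q := q) (D := D)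
    (R₀ := R₀) (R₁ := R1star p D + η) (ε := ε' / 2) (ε' := ε') hn (Set.Ioo_subset_Icc_self hp) hq
    (by linarith [hD.1])
  exact ⟨C, hC, by linarith⟩

lemma codeSize_le_rpow {R S : ℝ} {m n : ℕ} (hR : 0 ≤ R) (h : m * R + 1 ≤ n * S) :
    (codeSize R m : ℝ) ≤ (2 : ℝ) ^ (n * S) := by
  refine (codeSize_le hR m).trans ?_
  rw [mul_comm, ← Real.rpow_add_one two_ne_zero]
  exact Real.rpow_le_rpow_of_exponent_le one_le_two h

lemma eventually_two_le_natCast_mul (hη : 0 < η) : ∀ᶠ n : ℕ in atTop, 2 ≤ n * η :=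
  (tendsto_natCast_atTop_atTop.atTop_mul_const hη).eventually_ge_atTop 2

lemma wzAchievable_R1star (hp : p ∈ Set.Ioo 0 1) (hp' : p ≠ 1 / 2) (hD : D ∈ Set.Ico 0 1)
    (hD' : D ≠ 1 / 2) : WZAchievable p (R1star p D) D := by
  intro η hη
  obtain ⟨R₀, ε, ε', -, -, -, -, hcodes⟩ := exists_isSuperpositionCode_parameters hp half_mem_Icc
    hD hD' (h2_star_lt_h2_star_half hp' hD') (half_pos hη)
  have hpos := R1star_pos hp (Set.Ico_subset_Icc_self hD) hD'
  filter_upwards [hcodes, eventually_two_le_natCast_mul hη] with n ⟨C, _, hdist⟩ hn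
  exact ⟨_, C, codeSize_le_rpow (by positivity) (by linarith), by linarith⟩

/-- For `t = 0` the block length `⌊t * n⌋₊` stays `0`, hence the factor `⌊t * n⌋₊`. -/
lemma eventually_exists_isSuperpositionCode_floor (ht : 0 ≤ t) {d : ℝ}
    (h : ∀ᶠ m : ℕ in atTop, ∃ C : WZCode m (Fin (codeSize R₁ m)),
      IsSuperpositionCode p D ε ε' (codeSize R₀ m) C ∧ C.distortion p ≤ d) :
    ∀ᶠ n : ℕ in atTop, ∃ C : WZCode ⌊t * n⌋₊ (Fin (codeSize R₁ ⌊t * n⌋₊)),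
      IsSuperpositionCode p D ε ε' (codeSize R₀ ⌊t * n⌋₊) C ∧
        ⌊t * n⌋₊ * C.distortion p ≤ ⌊t * n⌋₊ * d := by
  rcases ht.eq_or_lt with rfl | htpos
  · refine Eventually.of_forall fun n => ?_
    obtain ⟨C, hC⟩ := exists_isSuperpositionCode p D ε ε' ⌊(0 : ℝ) * n⌋₊
      (codeSize_pos R₀ ⌊(0 : ℝ) * n⌋₊) (codeSize_pos R₁ ⌊(0 : ℝ) * n⌋₊)
    exact ⟨C, hC, by simp⟩
  · have hfloor : Tendsto (fun n : ℕ => ⌊t * n⌋₊) atTop atTop :=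
      tendsto_nat_floor_atTop.comp (tendsto_natCast_atTop_atTop.const_mul_atTop htpos)
    filter_upwards [hfloor.eventually h] with n ⟨C, hC, hdist⟩
    exact ⟨C, hC, by gcongr⟩

lemma floor_mul_natCast_le (ht : t ∈ Set.Icc 0 1) (n : ℕ) : ⌊t * n⌋₊ ≤ n :=
  Nat.floor_le_of_le (mul_le_of_le_one_left n.cast_nonneg ht.2)

lemma exists_timeShare_parameters (hp : p ∈ Set.Ioo 0 1) (hq : q ∈ Set.Icc 0 1)
    (hD : D ∈ Set.Ico 0 1) (hD' : D ≠ 1 / 2) (hpq : h2 (star p D) < h2 (star q D))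
    (ht : t ∈ Set.Icc 0 1) (hη : 0 < η) :
    ∃ R₀ R₁ ε ε' : ℝ, (R₀, R₁) ∈ rateRegion p q D ∧ R₁ < R1star p D + η ∧
      0 < ε ∧ ε < ε' ∧ ε' < η ∧
      ∀ᶠ n : ℕ in atTop,
        ∃ C : WZCode ⌊t * n⌋₊ (Fin (codeSize R₁ ⌊t * n⌋₊)),
          IsSuperpositionCode p D ε ε' (codeSize R₀ ⌊t * n⌋₊) C ∧
          (Nat.card (Fin (codeSize R₁ ⌊t * n⌋₊) × Unit) : ℝ) ≤
            (2 : ℝ) ^ ((n : ℝ) * (t * R1star p D + (1 - t) * 0 + η)) ∧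
          (timeShare C (sideInfoCode (n - ⌊t * n⌋₊))).distortion p ≤
            t * D + (1 - t) * p + η := by
  obtain ⟨R₀, ε, ε', hR, hε, hεε', hε', hcodes⟩ :=
    exists_isSuperpositionCode_parameters hp hq hD hD' hpq (half_pos hη)
  have hpos := R1star_pos hp (Set.Ico_subset_Icc_self hD) hD'
  refine ⟨R₀, R1star p D + η / 2, ε, ε', hR, by linarith, hε, hεε', by linarith, ?_⟩
  filter_upwards [eventually_exists_isSuperpositionCode_floor ht.1 hcodes,
    eventually_two_le_natCast_mul hη, eventually_gt_atTop 0] with n ⟨C, hC, hdist⟩ hlarge hn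
  have hn' : (0 : ℝ) < n := Nat.cast_pos.2 hn
  have hfloor : (⌊t * n⌋₊ : ℝ) ≤ t * n := Nat.floor_le (mul_nonneg ht.1 hn'.le)
  have htη : t * (η / 2) ≤ η / 2 := mul_le_of_le_one_left (half_pos hη).le ht.2
  refine ⟨C, hC, ?_, ?_⟩
  · rw [Nat.card_prod, Nat.card_eq_fintype_card, Fintype.card_fin, Nat.card_unique, mul_one]
    refine codeSize_le_rpow (by positivity) ?_
    calc ⌊t * n⌋₊ * (R1star p D + η / 2) + 1
        ≤ t * n * (R1star p D + η / 2) + n * (η / 2) := by gcongr; linarith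
      _ = n * (t * R1star p D + (t * (η / 2) + η / 2)) := by ring
      _ ≤ n * (t * R1star p D + (1 - t) * 0 + η) :=
          mul_le_mul_of_nonneg_left (by linarith) hn'.le
  · have hround : 1 / (n : ℝ) ≤ η / 2 := by
      rw [div_le_iff₀ hn']
      linarith
    have := distortion_timeShare_sideInfoCode_le (Set.Ioo_subset_Icc_self hp)
      (add_nonneg hD.1 (half_pos hη).le) hn (floor_mul_natCast_le ht n) hfloor
      (Nat.lt_floor_add_one _).le hdist
    linarith

lemma WZCode.exists_fin {M : Type} [Finite M] (C : WZCode n M) (p : ℝ) :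
    ∃ C' : WZCode n (Fin (Nat.card M)), C'.distortion p = C.distortion p :=
  ⟨⟨fun x => Finite.equivFin M (C.enc x), fun j y => C.dec ((Finite.equivFin M).symm j) y⟩, by
    simp only [WZCode.distortion, Equiv.symm_apply_apply]⟩

lemma wzAchievable_chord (hp : p ∈ Set.Ioo 0 1) (hp' : p ≠ 1 / 2) (hD : D ∈ Set.Ico 0 1)
    (hD' : D ≠ 1 / 2) (ht : t ∈ Set.Icc 0 1) :
    WZAchievable p (t * R1star p D + (1 - t) * 0) (t * D + (1 - t) * p) := by
  intro η hη
  obtain ⟨R₀, R₁, ε, ε', -, -, -, -, -, hcodes⟩ := exists_timeShare_parameters hp half_mem_Icc hD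
    hD' (h2_star_lt_h2_star_half hp' hD') ht hη
  filter_upwards [hcodes] with n ⟨C, _, hsize, hdist⟩
  obtain ⟨C', hC'⟩ := (timeShare C (sideInfoCode (n - ⌊t * n⌋₊))).exists_fin p
  have hcode : ∃ (M : ℕ) (C : WZCode (⌊t * n⌋₊ + (n - ⌊t * n⌋₊)) (Fin M)),
      (M : ℝ) ≤ (2 : ℝ) ^ ((n : ℝ) * (t * R1star p D + (1 - t) * 0 + η)) ∧
        C.distortion p ≤ t * D + (1 - t) * p + η := ⟨_, C', hsize, hC'.trans_le hdist⟩
  rwa [Nat.add_sub_cancel' (floor_mul_natCast_le ht n)] at hcode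

end Achievability

end SuperpositionWZ

theorem mainTheorem3 (p : ℝ) (hp0 : 0 < p) (hp : p < 1 / 2) :
    -- the rate region, and what it guarantees
    (∀ D : ℝ, 0 ≤ D → D < 1 / 2 →
      (∃ q : ℝ, 0 ≤ q ∧ q ≤ 1 ∧ h2 (star p D) < h2 (star q D)) ∧
      ∀ q : ℝ, 0 ≤ q → q ≤ 1 → h2 (star p D) < h2 (star q D) →
        {R₁ : ℝ | ∃ R₀ : ℝ, (R₀, R₁) ∈ rateRegion p q D} = Set.Ioi (R1star p D) ∧
        {R₁ : ℝ | ∃ R₀ : ℝ, (R₀, R₁) ∈ rateRegion p q D ∧ R₀ < 1 - h2 (star p D)} =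
          Set.Ioi (R1star p D) ∧
        ∀ R₀ R₁ : ℝ, (R₀, R₁) ∈ rateRegion p q D → R₀ < 1 - h2 (star p D) →
          ∃ ε₀ : ℝ, 0 < ε₀ ∧ ∀ ε ε' : ℝ, 0 < ε → ε < ε' → ε' < ε₀ →
            Tendsto (encErrorProb p q D R₀ R₁ ε) atTop (𝓝 0) ∧
            Tendsto (decErrorProb p q D R₀ R₁ ε ε') atTop (𝓝 0)) ∧
    -- the threshold distortion, and the Wyner-Ziv rate-distortion function
    (∃! D' : ℝ, IsThreshold p D') ∧
    ∀ D' : ℝ, IsThreshold p D' →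
      (∀ D : ℝ, 0 ≤ D → D ≤ D' → IsWZRate p D (R1star p D)) ∧
      ∀ D : ℝ, D' < D → D ≤ p → ∀ t : ℝ, t = (p - D) / (p - D') →
        D = t * D' + (1 - t) * p ∧
        IsWZRate p D (t * R1star p D' + (1 - t) * 0) ∧
        -- time-sharing of superposition codes with the zero-rate code attains it
        ∀ q : ℝ, 0 ≤ q → q ≤ 1 → h2 (star p D') < h2 (star q D') → ∀ η : ℝ, 0 < η →
          ∃ R₀ R₁ ε ε' : ℝ, (R₀, R₁) ∈ rateRegion p q D' ∧ R₁ < R1star p D' + η ∧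
            0 < ε ∧ ε < ε' ∧ ε' < η ∧
            ∀ᶠ n : ℕ in atTop,
              ∃ C : WZCode ⌊t * n⌋₊ (Fin (codeSize R₁ ⌊t * n⌋₊)),
                IsSuperpositionCode p D' ε ε' (codeSize R₀ ⌊t * n⌋₊) C ∧
                (Nat.card (Fin (codeSize R₁ ⌊t * n⌋₊) × Unit) : ℝ) ≤
                  (2 : ℝ) ^ ((n : ℝ) * (t * R1star p D' + (1 - t) * 0 + η)) ∧
                (timeShare C (sideInfoCode (n - ⌊t * n⌋₊))).distortion p ≤ D + η := by
  have hpI : p ∈ Set.Ioo 0 1 := ⟨hp0, by linarith⟩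
  refine ⟨fun D hD0 hD1 => ⟨⟨1 / 2, by norm_num, by norm_num,
    h2_star_lt_h2_star_half hp.ne hD1.ne⟩, fun q hq0 hq1 hpq =>
      ⟨setOf_exists_mem_rateRegion hpq, setOf_exists_mem_rateRegion_lt hpq, fun R₀ R₁ hR hR₀ =>
        exists_tendsto_errorProb hpI ⟨hq0, hq1⟩ ⟨hD0, by linarith⟩ hD1.ne hpq hR hR₀⟩⟩,
    existsUnique_isThreshold hpI hp.ne, fun D' hD' => ?_⟩
  have hD'I : D' ∈ Set.Ico 0 1 := ⟨hD'.1.le, by linarith [hD'.2.1]⟩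
  have hD'2 : D' ≠ 1 / 2 := (hD'.2.1.trans hp).ne
  refine ⟨fun D hD0 hD1 => ⟨wzAchievable_R1star hpI hp.ne ⟨hD0, hD1.trans_lt hD'I.2⟩
    (hD1.trans_lt (hD'.2.1.trans hp)).ne, fun R hR => hR.R1star_le hpI hp.le hD' ⟨hD0, hD1⟩⟩,
    fun D hD hDp t ht => ?_⟩
  have hpD : 0 < p - D' := sub_pos.2 hD'.2.1
  have htI : t ∈ Set.Icc 0 1 :=
    ⟨ht ▸ div_nonneg (by linarith) hpD.le, ht ▸ (div_le_one hpD).2 (by linarith)⟩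
  have hDt : D = t * D' + (1 - t) * p := by
    rw [ht]
    field_simp
    ring
  refine ⟨hDt, ⟨?_, fun R hR => ?_⟩, fun q hq0 hq1 hpq η hη => ?_⟩
  · rw [Set.mem_ofPred_eq, hDt]
    exact wzAchievable_chord hpI hp.ne hD'I hD'2 htI
  · rw [mul_zero, add_zero]
    exact (hDt ▸ hR).mul_R1star_le hpI hp.le hD'
  · rw [hDt]
    exact exists_timeShare_parameters hpI ⟨hq0, hq1⟩ hD'I hD'2 hpq htI hη
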